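/- For integers $r>s\ge 0$ let $B_{r,s}$ be the graph consisting of two copies of $K_r$ that share exactly $s$ vertices. A graph is $F$-free if it does not contain $F$ as a (not necessarily induced) subgraph. Let $\mathcal N(T,G)$ be the number of copies of $T$ in $G$, i.e. the number of subgraphs of $G$ isomorphic to $T$, and let $ex(n,T,F)$ be the maximum of $\mathcal N(T,G)$ over all $F$-free graphs $G$ on $n$ vertices. Let $T_k(m)$ be the Turán graph, i.e. the complete $k$-partite graph on $m$ vertices whose part sizes differ by at most one, and let $G_1\vee G_2$ be the join of $G_1$ and $G_2$, i.e. their disjoint union together with all edges between $V(G_1)$ and $V(G_2)$. **Theorem.** For every integer $r\ge 5$ there is an $n_0$ such that for all $n\ge n_0$, $$ex(n,K_r,B_{r,1})=\mathcal N\bigl(K_{r-2},\,T_{r-2}(n-2)\bigr),$$ and $K_2\vee T_{r-2}(n-2)$ is, up to isomorphism, the unique $B_{r,1}$-free graph on $n$ vertices that attains the maximum number of copies of $K_r$. -/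

import Mathlib

/-- The graph `B_{r,s}` (for `s < r`): two copies of `K_r` sharing exactly `s` vertices.
The vertex set is `{0, …, 2r - s - 1}`; one copy of `K_r` lives on the first `r` vertices and the
other one on the last `r` vertices `{r - s, …, 2r - s - 1}`, so that the common vertices are
`r - s, …, r - 1`. -/
def twoCliques (r s : ℕ) : SimpleGraph (Fin (2 * r - s)) where
  Adj i j := i ≠ j ∧ ((i.val < r ∧ j.val < r) ∨ (r - s ≤ i.val ∧ r - s ≤ j.val))
  symm := ⟨fun _ _ h => ⟨h.1.symm, h.2.imp And.symm And.symm⟩⟩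
  loopless := ⟨fun _ h => h.1 rfl⟩

/-- The join `G ∨ H`: the disjoint union of `G` and `H` together with all edges between them. -/
def graphJoin {V W : Type*} (G : SimpleGraph V) (H : SimpleGraph W) : SimpleGraph (V ⊕ W) :=
  (G ⊕g H) ⊔ completeBipartiteGraph V W

open Classical in
/-- The generalized Turán number `ex(n, T, F)`: the maximum number of (unlabelled) copies of `T`
in an `F`-free graph on `n` vertices. -/
noncomputable def generalizedTuranNumber (n : ℕ) {U W : Type*}
    (T : SimpleGraph U) (F : SimpleGraph W) : ℕ :=
  Finset.sup {G : SimpleGraph (Fin n) | F.Free G} fun G => G.copyCount T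

/-! ### Kernels of sunflowers in families avoiding intersections of size one. -/

section SetFamilies

open Finset
open scoped Classical

variable {α : Type*}

/-! Write r = k + 2. Being `B_{r,1}`-free means that the family 𝓕 of vertex sets of r-cliques has no
two members meeting in exactly one vertex. The proof is the delta-system method followed by a
stability argument.

Closing 𝓕 under kernels of sunflowers with r + 1 petals preserves the forbidden intersection size
(`Kern.card_inter_ne_one`). Each vertex lies in boundedly many minimal kernels, so all but
O(n^(r-3)) members F are "good": inside F, the minimal kernels around any W cover at most |W| + 2
vertices (`card_filter_kernelHull_le`). A good F contains a kernel P of size two such that P ∪ {x}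
is a kernel for every other x in F (`exists_kern_pair`).

Distinct kernel pairs have disjoint petals, so the petal sizes sum to at most n. The common
neighbourhood of a kernel pair is K_{k+1}-free, so by Zykov's theorem a petal of size p accounts for
at most `maxProd k p` ≤ (p/k)^k cliques. Since x^k is strictly convex, having as many cliques as the
construction forces one petal to contain all but O(1) vertices (`exists_large_petal`).

For that P, suppose some clique F₀ misses part of P. It lies in the bounded remainder, and for x in
F₀ each clique containing both P and x contains another vertex of F₀. So x lies in only O(n^(k-2))
cliques, while losing a vertex costs order n^(k-1) (`maxProd_gap`), a contradiction. Hence every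
clique contains P, and the equality cases of Zykov's theorem and of the product bound give a Turán
graph on the remaining n - 2 vertices. -/

/-- `S` is a sunflower with kernel `A`. -/
def IsSunflower (S : Finset (Finset α)) (A : Finset α) : Prop :=
  (∀ B ∈ S, A ⊆ B) ∧ ∀ B ∈ S, ∀ C ∈ S, B ≠ C → B ∩ C = A

/-- A family of sets of size at most `l` with more members than this contains a sunflower with
`t` petals. -/
def sunflowerBound (t : ℕ) : ℕ → ℕ
  | 0 => 1
  | l + 1 => 1 + t * (l + 1) * sunflowerBound t l

/-- Erdős–Rado: take a largest pairwise disjoint subfamily. If it has t members, they form a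
sunflower with empty kernel. Otherwise its union has at most t(l+1) points and meets every nonempty
member, so some point u lies in many members; delete u and induct. The summand 1 in `sunflowerBound`
pays for the empty set. -/
theorem exists_sunflower (t l : ℕ) (𝓐 : Finset (Finset α)) (hl : ∀ B ∈ 𝓐, #B ≤ l)
    (hc : sunflowerBound t l < #𝓐) : ∃ S ⊆ 𝓐, #S = t ∧ ∃ A, IsSunflower S A := by
  induction l generalizing 𝓐 with
  | zero =>
    exfalso
    have : 𝓐 ⊆ {∅} := by
      intro B hB
      simpa using hl B hB
    have := card_le_card this
    simp only [sunflowerBound, card_singleton] at *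
    omega
  | succ l ih =>
    obtain ⟨D, hD, hmax⟩ := exists_max_image
      (𝓐.powerset.filter fun D => ∀ B ∈ D, ∀ C ∈ D, B ≠ C → B ∩ C = ∅) card ⟨∅, by simp⟩
    simp only [mem_filter, mem_powerset] at hD hmax
    obtain ⟨hDA, hDd⟩ := hD
    by_cases ht : t ≤ #D
    · obtain ⟨S, hS, hSt⟩ := exists_subset_card_eq ht
      exact ⟨S, hS.trans hDA, hSt, ∅, by simp, fun B hB C hC => hDd B (hS hB) C (hS hC)⟩
    push Not at ht
    set U := D.biUnion id with hU
    have hUc : #U ≤ t * (l + 1) :=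
      (card_biUnion_le_card_mul D id (l + 1) fun B hB => hl B (hDA hB)).trans
        (Nat.mul_le_mul_right _ ht.le)
    have hcov : 𝓐 ⊆ {∅} ∪ U.biUnion fun u => 𝓐.filter (u ∈ ·) := by
      intro B hB
      by_contra hcon
      simp only [mem_union, mem_singleton, mem_biUnion, mem_filter, not_or, not_exists,
        not_and] at hcon
      obtain ⟨hne, hBU⟩ := hcon
      have hdis : ∀ C ∈ D, B ∩ C = ∅ := by
        intro C hC
        rw [eq_empty_iff_forall_notMem]
        intro x hx
        rw [mem_inter] at hx
        exact hBU x (mem_biUnion.2 ⟨C, hC, hx.2⟩) hB hx.1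
      have hBD : B ∉ D := fun h => hne (by simpa using hdis B h)
      have := hmax (insert B D) ⟨insert_subset hB hDA, by
        intro X hX Y hY hXY
        rw [mem_insert] at hX hY
        rcases hX with rfl | hX <;> rcases hY with rfl | hY
        · exact absurd rfl hXY
        · exact hdis Y hY
        · rw [inter_comm]; exact hdis X hX
        · exact hDd X hX Y hY hXY⟩
      rw [card_insert_of_notMem hBD] at this
      omega
    obtain ⟨u, -, hu⟩ : ∃ u ∈ U, sunflowerBound t l < #(𝓐.filter (u ∈ ·)) := by
      by_contra! hcon
      have h1 := card_le_card hcov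
      have h2 := card_union_le {∅} (U.biUnion fun u => 𝓐.filter (u ∈ ·))
      have h3 := card_biUnion_le_card_mul U (fun u => 𝓐.filter (u ∈ ·)) _ hcon
      have h4 := Nat.mul_le_mul_right (sunflowerBound t l) hUc
      simp only [sunflowerBound, card_singleton] at *
      omega
    have hinj : Set.InjOn (fun B : Finset α => B.erase u) (𝓐.filter (u ∈ ·)) := by
      intro B hB C hC h
      simp only [coe_filter, Set.mem_ofPred_eq] at hB hC
      rw [← insert_erase hB.2, ← insert_erase hC.2]
      simp only at h
      rw [h]
    obtain ⟨S, hS, hSt, A, hA⟩ := ih ((𝓐.filter (u ∈ ·)).image fun B => B.erase u)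
      (by
        simp only [mem_image, mem_filter]
        rintro _ ⟨B, ⟨hB, huB⟩, rfl⟩
        rw [card_erase_of_mem huB]
        have := hl B hB
        omega)
      (by rwa [card_image_of_injOn hinj])
    have hS' : ∀ B ∈ S, u ∉ B ∧ insert u B ∈ 𝓐 := by
      intro B hB
      obtain ⟨C, hC, rfl⟩ := mem_image.1 (hS hB)
      rw [mem_filter] at hC
      exact ⟨by simp, by rw [insert_erase hC.2]; exact hC.1⟩
    refine ⟨S.image (insert u), ?_, ?_, insert u A, ?_, ?_⟩
    · intro B hB
      obtain ⟨C, hC, rfl⟩ := mem_image.1 hB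
      exact (hS' C hC).2
    · rw [card_image_of_injOn, hSt]
      intro B hB C hC h
      have h : insert u B = insert u C := h
      rw [← erase_insert (hS' B hB).1, ← erase_insert (hS' C hC).1, h]
    · intro B hB
      obtain ⟨C, hC, rfl⟩ := mem_image.1 hB
      exact insert_subset_insert u (hA.1 C hC)
    · intro B hB C hC h
      obtain ⟨B, hB', rfl⟩ := mem_image.1 hB
      obtain ⟨C, hC', rfl⟩ := mem_image.1 hC
      rw [← insert_inter_distrib, hA.2 B hB' C hC' fun h' => h (by rw [h'])]

/-- The closure of a set family under taking kernels of sunflowers with `t` petals. -/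
inductive Kern (𝓕 : Finset (Finset α)) (t : ℕ) : Finset α → Prop
  | base (F : Finset α) (hF : F ∈ 𝓕) : Kern 𝓕 t F
  | kernel (S : Finset (Finset α)) (A : Finset α) (ht : #S = t)
      (hS : ∀ B, B ∈ S → Kern 𝓕 t B) (hA : IsSunflower S A) : Kern 𝓕 t A

theorem Kern.card_le {𝓕 : Finset (Finset α)} {r : ℕ} (h𝓕 : ∀ F ∈ 𝓕, #F = r) {K : Finset α}
    (hK : Kern 𝓕 (r + 1) K) : #K ≤ r := by
  induction hK with
  | base F hF => exact (h𝓕 F hF).le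
  | kernel S A ht hS hA ih =>
    obtain ⟨B, hB⟩ : S.Nonempty := by rw [← card_pos]; omega
    exact (card_le_card (hA.1 B hB)).trans (ih B hB)

/-- If a kernel A met X in one point, each of its r + 1 petals would have to meet X in a further
point outside A. Petals are disjoint outside A, so X would have at least r + 1 points. -/
theorem Kern.card_inter_ne_one_of_base {𝓕 : Finset (Finset α)} {r : ℕ} {X : Finset α}
    (hX : #X ≤ r) (h : ∀ F ∈ 𝓕, #(F ∩ X) ≠ 1) {K : Finset α} (hK : Kern 𝓕 (r + 1) K) :
    #(K ∩ X) ≠ 1 := by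
  induction hK with
  | base F hF => exact h F hF
  | kernel S A ht hS hA ih =>
    intro hone
    have key : ∀ B ∈ S, ∃ x, x ∈ X ∧ x ∈ B ∧ x ∉ A := by
      intro B hB
      by_contra! hcon
      apply ih B hB
      rw [← hone]
      congr 1
      ext x
      simp only [mem_inter]
      exact ⟨fun hx => ⟨hcon x hx.2 hx.1, hx.2⟩, fun hx => ⟨hA.1 B hB hx.1, hx.2⟩⟩
    obtain ⟨a, -⟩ := card_pos.1 (by omega : 0 < #(A ∩ X))
    have : Nonempty α := ⟨a⟩
    choose! f hfX hfB hfA using key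
    have hinj : Set.InjOn f (S : Set (Finset α)) := by
      intro B hB C hC hBC
      by_contra hne
      apply hfA B hB
      rw [← hA.2 B hB C hC hne, mem_inter]
      exact ⟨hfB B hB, hBC ▸ hfB C hC⟩
    have := card_le_card_of_injOn f (fun B hB => hfX B hB) hinj
    omega

/-- The one-sided statement is used twice: first to pass from members to L, then from members to K.
The case K = L shows that no kernel is a singleton. -/
theorem Kern.card_inter_ne_one {𝓕 : Finset (Finset α)} {r : ℕ} (h𝓕 : ∀ F ∈ 𝓕, #F = r)
    (h : ∀ F ∈ 𝓕, ∀ F' ∈ 𝓕, #(F ∩ F') ≠ 1) {K L : Finset α} (hK : Kern 𝓕 (r + 1) K)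
    (hL : Kern 𝓕 (r + 1) L) : #(K ∩ L) ≠ 1 := by
  refine hK.card_inter_ne_one_of_base (hL.card_le h𝓕) fun F hF => ?_
  rw [inter_comm]
  exact hL.card_inter_ne_one_of_base (h𝓕 F hF).le fun F' hF' => h F' hF' F hF

variable [Fintype α]

/-- The minimal members of `Kern 𝓕 t` containing `v`. -/
noncomputable def minKern (𝓕 : Finset (Finset α)) (t : ℕ) (v : α) : Finset (Finset α) :=
  univ.filter fun K => Kern 𝓕 t K ∧ v ∈ K ∧ ∀ L, Kern 𝓕 t L → v ∈ L → L ⊆ K → L = K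

theorem mem_minKern {𝓕 : Finset (Finset α)} {t : ℕ} {v : α} {K : Finset α} :
    K ∈ minKern 𝓕 t v ↔ Kern 𝓕 t K ∧ v ∈ K ∧ ∀ L, Kern 𝓕 t L → v ∈ L → L ⊆ K → L = K := by
  simp [minKern]

theorem exists_mem_minKern {𝓕 : Finset (Finset α)} {t : ℕ} {v : α} {K : Finset α}
    (hK : Kern 𝓕 t K) (hv : v ∈ K) : ∃ L ∈ minKern 𝓕 t v, L ⊆ K := by
  obtain ⟨L, hL, hmin⟩ := exists_min_image
    (univ.filter fun L => Kern 𝓕 t L ∧ v ∈ L ∧ L ⊆ K) card ⟨K, by simp [hK, hv]⟩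
  simp only [mem_filter, mem_univ, true_and] at hL hmin
  refine ⟨L, mem_minKern.2 ⟨hL.1, hL.2.1, fun M hM hvM hML => ?_⟩, hL.2.2⟩
  exact eq_of_subset_of_card_le hML (hmin M ⟨hM, hvM, hML.trans hL.2.2⟩)

/-- A sunflower with r + 1 petals among the minimal kernels through v would have a kernel that again
contains v and belongs to the closure. Minimality would make all petals equal to it. -/
theorem card_minKern_le {𝓕 : Finset (Finset α)} {r : ℕ} (h𝓕 : ∀ F ∈ 𝓕, #F = r) (hr : 1 ≤ r)
    (v : α) : #(minKern 𝓕 (r + 1) v) ≤ sunflowerBound (r + 1) r := by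
  by_contra! hcon
  obtain ⟨S, hS, hSt, A, hA⟩ := exists_sunflower (r + 1) r _
    (fun B hB => (mem_minKern.1 hB).1.card_le h𝓕) hcon
  obtain ⟨B, hB, C, hC, hBC⟩ := one_lt_card.1 (by omega : 1 < #S)
  have hKA : Kern 𝓕 (r + 1) A := .kernel S A hSt (fun B hB => (mem_minKern.1 (hS hB)).1) hA
  have hvA : v ∈ A := by
    rw [← hA.2 B hB C hC hBC, mem_inter]
    exact ⟨(mem_minKern.1 (hS hB)).2.1, (mem_minKern.1 (hS hC)).2.1⟩
  apply hBC
  rw [← (mem_minKern.1 (hS hB)).2.2 A hKA hvA (hA.1 B hB),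
    ← (mem_minKern.1 (hS hC)).2.2 A hKA hvA (hA.1 C hC)]

/-- The union of the minimal kernels inside `F` around the vertices of `W`. -/
noncomputable def kernelHull (𝓕 : Finset (Finset α)) (t : ℕ) (F W : Finset α) : Finset α :=
  ((W.biUnion (minKern 𝓕 t)).filter (· ⊆ F)).biUnion id

theorem subset_kernelHull {𝓕 : Finset (Finset α)} {t : ℕ} {F W K : Finset α} {v : α}
    (hv : v ∈ W) (hK : K ∈ minKern 𝓕 t v) (hKF : K ⊆ F) : K ⊆ kernelHull 𝓕 t F W := by
  intro x hx
  simp only [kernelHull, mem_biUnion, mem_filter, id]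
  exact ⟨K, ⟨⟨v, hv, hK⟩, hKF⟩, hx⟩

theorem kernelHull_subset {𝓕 : Finset (Finset α)} {t : ℕ} {F W : Finset α} :
    kernelHull 𝓕 t F W ⊆ F := by
  intro x hx
  simp only [kernelHull, mem_biUnion, mem_filter, id] at hx
  obtain ⟨K, ⟨-, hKF⟩, hx⟩ := hx
  exact hKF hx

theorem card_filter_superset_le (r : ℕ) (X : Finset α) :
    #(univ.filter fun F : Finset α => #F = r ∧ X ⊆ F) ≤ Fintype.card α ^ (r - #X) := by
  calc _ ≤ #(powersetCard (r - #X) (univ : Finset α)) := by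
        refine card_le_card_of_injOn (· \ X) ?_ ?_
        · intro F hF
          simp only [coe_filter, mem_univ, true_and, Set.mem_ofPred_eq] at hF
          simp [mem_powersetCard, card_sdiff_of_subset hF.2, hF.1]
        · intro F hF F' hF' h
          simp only [coe_filter, mem_univ, true_and, Set.mem_ofPred_eq] at hF hF' h
          rw [← sdiff_union_of_subset hF.2, ← sdiff_union_of_subset hF'.2, h]
    _ ≤ _ := by
        rw [card_powersetCard, card_univ]
        exact Nat.choose_le_pow _ _

/-- In all but `O(n^(r-3))` members of the family, kernel hulls are small. -/
theorem card_filter_kernelHull_le {𝓕 : Finset (Finset α)} {r : ℕ} (h𝓕 : ∀ F ∈ 𝓕, #F = r)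
    (hr : 3 ≤ r) :
    #(𝓕.filter fun F => ∃ W ⊆ F, #W + 3 ≤ #(kernelHull 𝓕 (r + 1) F W)) ≤
      r * 2 ^ (r * sunflowerBound (r + 1) r) * Fintype.card α ^ (r - 3) := by
  set B := sunflowerBound (r + 1) r
  set n := Fintype.card α
  -- Encode a bad F by j = |W|, the set W (at most n^j choices), the subfamily T of minimal kernels
  -- around W lying in F (boundedly many choices), and the at most r - (j + 3) vertices of F outside
  -- the union of T. The exponents add up to r - 3. The range suffices because j + 3 ≤ |F| = r.
  calc _ ≤ #((range (r - 2)).biUnion fun j => (powersetCard j (univ : Finset α)).biUnion fun W =>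
          (((W.biUnion (minKern 𝓕 (r + 1))).powerset).filter
            fun T => j + 3 ≤ #(T.biUnion id)).biUnion fun T =>
              univ.filter fun F : Finset α => #F = r ∧ T.biUnion id ⊆ F) := by
        refine card_le_card fun F hF => ?_
        rw [mem_filter] at hF
        obtain ⟨hF, W, hWF, hW⟩ := hF
        have := card_le_card (kernelHull_subset : kernelHull 𝓕 (r + 1) F W ⊆ F)
        rw [h𝓕 F hF] at this
        refine mem_biUnion.2 ⟨#W, by rw [mem_range]; omega, mem_biUnion.2
          ⟨W, by simp [mem_powersetCard], mem_biUnion.2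
            ⟨(W.biUnion (minKern 𝓕 (r + 1))).filter (· ⊆ F), ?_, ?_⟩⟩⟩
        · rw [mem_filter, mem_powerset]
          exact ⟨filter_subset _ _, hW⟩
        · rw [mem_filter]
          exact ⟨mem_univ _, h𝓕 F hF, kernelHull_subset⟩
    _ ≤ #(range (r - 2)) * (2 ^ (r * B) * n ^ (r - 3)) := by
        refine card_biUnion_le_card_mul _ _ _ fun j hj => ?_
        rw [mem_range] at hj
        calc _ ≤ #(powersetCard j (univ : Finset α)) * (2 ^ (r * B) * n ^ (r - (j + 3))) := by
              refine card_biUnion_le_card_mul _ _ _ fun W hW => ?_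
              rw [mem_powersetCard] at hW
              refine (card_biUnion_le_card_mul _ _ (n ^ (r - (j + 3))) fun T hT => ?_).trans
                (Nat.mul_le_mul_right _ ?_)
              · rw [mem_filter] at hT
                refine (card_filter_superset_le r _).trans ?_
                rcases Nat.eq_zero_or_pos n with hn | hn
                · have : IsEmpty α := Fintype.card_eq_zero_iff.1 hn
                  have := hT.2
                  rw [Finset.eq_empty_of_isEmpty (T.biUnion id)] at this
                  simp at this
                · exact Nat.pow_le_pow_right hn (by omega)
              · refine (card_filter_le _ _).trans ?_
                rw [card_powerset]
                refine Nat.pow_le_pow_right (by norm_num) ?_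
                refine (card_biUnion_le_card_mul W _ B fun v _ =>
                  card_minKern_le h𝓕 (by omega) v).trans (Nat.mul_le_mul_right _ (by omega))
          _ ≤ n ^ j * (2 ^ (r * B) * n ^ (r - (j + 3))) := by
              refine Nat.mul_le_mul_right _ ?_
              rw [card_powersetCard, card_univ]
              exact Nat.choose_le_pow _ _
          _ = 2 ^ (r * B) * n ^ (r - 3) := by
              rw [mul_left_comm, ← pow_add]
              congr 2
              omega
    _ ≤ r * (2 ^ (r * B) * n ^ (r - 3)) := Nat.mul_le_mul_right _ (by rw [card_range]; omega)
    _ = _ := by ring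

/-- A member all of whose kernel hulls are small is generated by a pair. -/
theorem exists_kern_pair {𝓕 : Finset (Finset α)} {r : ℕ} (h𝓕 : ∀ F ∈ 𝓕, #F = r) (hr : 5 ≤ r)
    (hint : ∀ F ∈ 𝓕, ∀ F' ∈ 𝓕, #(F ∩ F') ≠ 1) {F : Finset α} (hF : F ∈ 𝓕)
    (hgood : ∀ W ⊆ F, #(kernelHull 𝓕 (r + 1) F W) < #W + 3) :
    ∃ P, #P = 2 ∧ Kern 𝓕 (r + 1) P ∧ P ⊆ F ∧ ∀ x ∈ F, x ∉ P → Kern 𝓕 (r + 1) (insert x P) := by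
  have hFr := h𝓕 F hF
  have I : ∀ K L, Kern 𝓕 (r + 1) K → Kern 𝓕 (r + 1) L → #(K ∩ L) ≠ 1 :=
    fun K L hK hL => hK.card_inter_ne_one h𝓕 hint hL
  have one : ∀ K, Kern 𝓕 (r + 1) K → #K ≠ 1 := fun K hK => by simpa using I K K hK hK
  have hex : ∀ v ∈ F, ∃ L ∈ minKern 𝓕 (r + 1) v, L ⊆ F :=
    fun v hv => exists_mem_minKern (.base F hF) hv
  choose! K hKmin hKF using hex
  have hKern : ∀ v ∈ F, Kern 𝓕 (r + 1) (K v) := fun v hv => (mem_minKern.1 (hKmin v hv)).1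
  have hmem : ∀ v ∈ F, v ∈ K v := fun v hv => (mem_minKern.1 (hKmin v hv)).2.1
  have two : ∀ v ∈ F, 2 ≤ #(K v) := by
    intro v hv
    have h1 := card_pos.2 ⟨v, hmem v hv⟩
    have h2 := one _ (hKern v hv)
    omega
  have three : ∀ v ∈ F, #(K v) ≤ 3 := by
    intro v hv
    have h1 := hgood {v} (by simpa using hv)
    have h2 := card_le_card (subset_kernelHull (mem_singleton_self v) (hKmin v hv) (hKF v hv))
    rw [card_singleton] at h1
    omega
  by_cases hpair : ∃ P, Kern 𝓕 (r + 1) P ∧ #P = 2 ∧ P ⊆ F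
  · obtain ⟨P, hP, hP2, hPF⟩ := hpair
    have closed : ∀ Q L, Kern 𝓕 (r + 1) Q → #Q = 2 → Kern 𝓕 (r + 1) L →
        ¬ Disjoint L Q → Q ⊆ L := by
      intro Q L hQ hQ2 hL hd
      have h1 := I L Q hL hQ
      have h2 : 0 < #(L ∩ Q) := by
        rw [card_pos, nonempty_iff_ne_empty, Ne, ← disjoint_iff_inter_eq_empty]
        exact hd
      have h3 : L ∩ Q = Q := eq_of_subset_of_card_le inter_subset_right (by omega)
      rw [← h3]
      exact inter_subset_left
    obtain ⟨p, hp⟩ : P.Nonempty := by rw [← card_pos]; omega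
    have hpF := hPF hp
    have hPmin : P ∈ minKern 𝓕 (r + 1) p := by
      refine mem_minKern.2 ⟨hP, hp, fun L hL hpL hLP => eq_of_subset_of_card_le hLP ?_⟩
      have h1 := card_pos.2 ⟨p, hpL⟩
      have h2 := one _ hL
      omega
    refine ⟨P, hP2, hP, hPF, fun w hw hwP => ?_⟩
    -- A minimal kernel around w that meets P contains P and has at most three points, so it is P ∪
    -- {w}. It remains to exclude disjointness.
    by_cases hd : Disjoint (K w) P
    · exfalso
      have hPw : #(P ∪ K w) = 2 + #(K w) := by
        rw [card_union_of_disjoint hd.symm, hP2]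
      have hsub : ∀ W : Finset α, p ∈ W → P ⊆ kernelHull 𝓕 (r + 1) F W :=
        fun W hW => subset_kernelHull hW hPmin hPF
      have hsubK : ∀ W : Finset α, ∀ v ∈ F, v ∈ W → K v ⊆ kernelHull 𝓕 (r + 1) F W :=
        fun W v hv hW => subset_kernelHull hW (hKmin v hv) (hKF v hv)
      have hw2 : #(K w) = 2 := by
        have h1 := hgood {p, w} (by simp [insert_subset_iff, hpF, hw])
        have h2 := card_le_card (union_subset (hsub {p, w} (by simp))
          (hsubK {p, w} w hw (by simp)))
        have h3 := card_le_two (a := p) (b := w)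
        have h4 := two w hw
        omega
      -- P and K w are now disjoint pairs, and r ≥ 5 leaves a fifth vertex z. If K z is disjoint
      -- from both pairs, the hull of {p, w, z} has at least 6 points. If K z meets one pair it
      -- contains it, and then z together with a point of the other pair generates at least 5
      -- points. Both exceed the allowed |W| + 2.
      obtain ⟨z, hz, hzn⟩ : ∃ z ∈ F, z ∉ P ∪ K w :=
        exists_mem_notMem_of_card_lt_card (by omega)
      have h5 : #(insert z (P ∪ K w)) = 5 := by
        rw [card_insert_of_notMem hzn]; omega
      have hzK := singleton_subset_iff.2 (hmem z hz)
      by_cases hzP : Disjoint (K z) P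
      · by_cases hzw : Disjoint (K z) (K w)
        · have h1 := hgood {p, w, z} (by simp [insert_subset_iff, hpF, hw, hz])
          have h2 := card_le_card (union_subset (union_subset (hsub {p, w, z} (by simp))
            (hsubK {p, w, z} w hw (by simp))) (hsubK {p, w, z} z hz (by simp)))
          rw [card_union_of_disjoint (disjoint_union_left.2 ⟨hzP.symm, hzw.symm⟩)] at h2
          have h3 := card_le_three (a := p) (b := w) (c := z)
          have h4 := two z hz
          omega
        · have h1 := hgood {p, z} (by simp [insert_subset_iff, hpF, hz])
          have hs := hsubK {p, z} z hz (by simp)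
          have h2 := card_le_card (insert_subset (hs (hmem z hz))
            (union_subset (hsub {p, z} (by simp))
              ((closed _ _ (hKern w hw) hw2 (hKern z hz) hzw).trans hs)))
          have h3 := card_le_two (a := p) (b := z)
          omega
      · have h1 := hgood {w, z} (by simp [insert_subset_iff, hw, hz])
        have hs := hsubK {w, z} z hz (by simp)
        have h2 := card_le_card (insert_subset (hs (hmem z hz))
          (union_subset ((closed _ _ hP hP2 (hKern z hz) hzP).trans hs)
            (hsubK {w, z} w hw (by simp))))
        have h3 := card_le_two (a := w) (b := z)
        omega
    · have h1 := closed P _ hP hP2 (hKern w hw) hd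
      have h2 : insert w P = K w := by
        refine eq_of_subset_of_card_le (insert_subset (hmem w hw) h1) ?_
        rw [card_insert_of_notMem hwP, hP2]
        exact three w hw
      rw [h2]
      exact hKern w hw
  -- Without kernel pairs inside F, each K v is a triple and is minimal around each of its points.
  -- Take two different triples: if disjoint, two vertices generate 6 points; if they share a, the
  -- vertex a alone generates at least 4.
  · exfalso
    have no2 : ∀ L, Kern 𝓕 (r + 1) L → L ⊆ F → #L ≠ 2 := fun L hL hLF h2 =>
      hpair ⟨L, hL, h2, hLF⟩
    have hmin : ∀ v ∈ F, ∀ a ∈ K v, K v ∈ minKern 𝓕 (r + 1) a := by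
      intro v hv a ha
      refine mem_minKern.2 ⟨hKern v hv, ha, fun L hL haL hLK => eq_of_subset_of_card_le hLK ?_⟩
      have h1 := card_pos.2 ⟨a, haL⟩
      have h2 := one _ hL
      have h3 := no2 L hL (hLK.trans (hKF v hv))
      have h4 := three v hv
      omega
    obtain ⟨u, hu⟩ : F.Nonempty := by rw [← card_pos]; omega
    obtain ⟨v, hv, hvu⟩ : ∃ v ∈ F, v ∉ K u :=
      exists_mem_notMem_of_card_lt_card (by have := three u hu; omega)
    have hu3 : #(K u) = 3 := by
      have h1 := three u hu
      have h2 := two u hu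
      have h3 := no2 _ (hKern u hu) (hKF u hu)
      omega
    have hv3 : #(K v) = 3 := by
      have h1 := three v hv
      have h2 := two v hv
      have h3 := no2 _ (hKern v hv) (hKF v hv)
      omega
    have hnd : ¬ Disjoint (K u) (K v) := by
      intro hd
      have h1 := hgood {u, v} (by simp [insert_subset_iff, hu, hv])
      have h2 := card_le_card (union_subset
        (subset_kernelHull (W := {u, v}) (by simp) (hKmin u hu) (hKF u hu))
        (subset_kernelHull (W := {u, v}) (by simp) (hKmin v hv) (hKF v hv)))
      rw [card_union_of_disjoint hd] at h2
      have h3 := card_le_two (a := u) (b := v)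
      omega
    obtain ⟨a, hau, hav⟩ := not_disjoint_iff.1 hnd
    have h1 := hgood {a} (by simpa using hKF u hu hau)
    have h2 := card_le_card (insert_subset
      (subset_kernelHull (mem_singleton_self a) (hmin v hv a hav) (hKF v hv) (hmem v hv))
      (subset_kernelHull (mem_singleton_self a) (hmin u hu a hau) (hKF u hu)))
    rw [card_insert_of_notMem hvu, hu3] at h2
    rw [card_singleton] at h1
    omega

end SetFamilies

/-! ### Zykov's theorem with its equality case. -/

section CliqueCounting

open Finset
open scoped Classical

variable {V : Type*}

/-- The cliques with `k` vertices inside the vertex set `S`. -/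
noncomputable def cliquesIn (G : SimpleGraph V) (S : Finset V) (k : ℕ) : Finset (Finset V) :=
  (S.powersetCard k).filter fun Q => G.IsClique (Q : Set V)

theorem mem_cliquesIn {G : SimpleGraph V} {S Q : Finset V} {k : ℕ} :
    Q ∈ cliquesIn G S k ↔ Q ⊆ S ∧ #Q = k ∧ G.IsClique (Q : Set V) := by
  simp [cliquesIn, mem_powersetCard, and_assoc]

theorem cliquesIn_mono (G : SimpleGraph V) {S T : Finset V} (h : S ⊆ T) (k : ℕ) :
    cliquesIn G S k ⊆ cliquesIn G T k := by
  intro Q hQ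
  rw [mem_cliquesIn] at *
  exact ⟨hQ.1.trans h, hQ.2⟩

theorem insert_mem_cliquesIn {G : SimpleGraph V} {S Q : Finset V} {k : ℕ} {v : V} (hv : v ∈ S)
    (hQ : Q ∈ cliquesIn G (S.filter (G.Adj v)) k) : insert v Q ∈ cliquesIn G S (k + 1) := by
  rw [mem_cliquesIn] at *
  obtain ⟨hQS, hQk, hQc⟩ := hQ
  have hadj : ∀ w ∈ Q, G.Adj v w := fun w hw => (mem_filter.1 (hQS hw)).2
  refine ⟨insert_subset hv (hQS.trans (filter_subset _ _)), ?_, ?_⟩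
  · rw [card_insert_of_notMem fun h => G.irrefl (hadj v h), hQk]
  · rw [coe_insert]
    exact hQc.insert fun b hb _ => hadj b hb

theorem erase_mem_cliquesIn {G : SimpleGraph V} {S Q : Finset V} {k : ℕ} {v : V} (hv : v ∈ Q)
    (hQ : Q ∈ cliquesIn G S (k + 1)) : Q.erase v ∈ cliquesIn G (S.filter (G.Adj v)) k := by
  rw [mem_cliquesIn] at *
  obtain ⟨hQS, hQk, hQc⟩ := hQ
  refine ⟨fun w hw => ?_, by rw [card_erase_of_mem hv, hQk]; rfl, hQc.subset (by simp)⟩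
  rw [mem_erase] at hw
  exact mem_filter.2 ⟨hQS hw.2, hQc hv hw.2 hw.1.symm⟩

/-- Transversals of the parts of a complete multipartite graph are cliques. -/
theorem image_mem_cliquesIn {G : SimpleGraph V} {S : Finset V} {k : ℕ} {f : V → ℕ}
    (hf : ∀ u ∈ S, ∀ v ∈ S, G.Adj u v ↔ f u ≠ f v) {g : Fin k → V}
    (hg : ∀ i, g i ∈ S ∧ f (g i) = i) : univ.image g ∈ cliquesIn G S k := by
  have hinj : Function.Injective g := by
    intro i j h
    rw [Fin.ext_iff, ← (hg i).2, ← (hg j).2, h]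
  rw [mem_cliquesIn]
  refine ⟨?_, by rw [card_image_of_injective _ hinj, card_univ, Fintype.card_fin], ?_⟩
  · intro v hv
    obtain ⟨i, -, rfl⟩ := mem_image.1 hv
    exact (hg i).1
  · intro u hu v hv huv
    obtain ⟨i, -, rfl⟩ := mem_image.1 (mem_coe.1 hu)
    obtain ⟨j, -, rfl⟩ := mem_image.1 (mem_coe.1 hv)
    rw [hf _ (hg i).1 _ (hg j).1, (hg i).2, (hg j).2]
    exact fun h => huv (by rw [Fin.ext h])

theorem prod_card_le_card_cliquesIn {G : SimpleGraph V} {S : Finset V} {k : ℕ} {f : V → ℕ}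
    (hf : ∀ u ∈ S, ∀ v ∈ S, G.Adj u v ↔ f u ≠ f v) :
    ∏ i ∈ range k, #(S.filter (f · = i)) ≤ #(cliquesIn G S k) := by
  rw [prod_range, ← Fintype.card_piFinset]
  refine card_le_card_of_injOn (fun g => univ.image g) ?_ ?_
  · intro g hg
    refine image_mem_cliquesIn hf fun i => ?_
    simpa using Fintype.mem_piFinset.1 hg i
  · intro g hg g' hg' h
    have hg := fun i => mem_filter.1 (Fintype.mem_piFinset.1 hg i)
    have hg' := fun i => mem_filter.1 (Fintype.mem_piFinset.1 hg' i)
    funext i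
    have h1 : g i ∈ univ.image g' := by
      rw [← show univ.image g = univ.image g' from h]
      exact mem_image_of_mem g (mem_univ i)
    obtain ⟨j, -, hj⟩ := mem_image.1 h1
    have : j = i := by rw [Fin.ext_iff, ← (hg i).2, ← (hg' j).2, hj]
    rw [← hj, this]

/-- Detects double counting: in the equality case of Zykov's theorem no clique may be counted at two
vertices. -/
theorem card_biUnion_lt_sum {ι β : Type*} [DecidableEq β] {s : Finset ι} {F : ι → Finset β} {a b : ι} {x : β}
    (ha : a ∈ s) (hb : b ∈ s) (hab : a ≠ b) (hxa : x ∈ F a) (hxb : x ∈ F b) :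
    #(s.biUnion F) < ∑ i ∈ s, #(F i) := by
  rw [← insert_erase ha, biUnion_insert, sum_insert (notMem_erase a s)]
  have h1 := card_union_add_card_inter (F a) ((s.erase a).biUnion F)
  have h2 : 0 < #(F a ∩ (s.erase a).biUnion F) :=
    card_pos.2 ⟨x, mem_inter.2 ⟨hxa, mem_biUnion.2 ⟨b, mem_erase.2 ⟨hab.symm, hb⟩, hxb⟩⟩⟩
  have h3 : #((s.erase a).biUnion F) ≤ ∑ i ∈ s.erase a, #(F i) := card_biUnion_le
  omega

/-- **Zykov's theorem**: in a `K_{k+1}`-free graph, the number of `k`-cliques is at most the product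
of the part sizes of some partition into `k` parts, and equality forces the graph to be
complete multipartite with respect to this partition. -/
theorem exists_coloring_card_cliquesIn_le (G : SimpleGraph V) (k : ℕ) (S : Finset V)
    (hfree : cliquesIn G S (k + 1) = ∅) :
    ∃ f : V → ℕ, (∀ v ∈ S, f v < k) ∧
      #(cliquesIn G S k) ≤ ∏ i ∈ range k, #(S.filter (f · = i)) ∧
      (0 < #(cliquesIn G S k) → #(cliquesIn G S k) = ∏ i ∈ range k, #(S.filter (f · = i)) →
        ∀ u ∈ S, ∀ v ∈ S, G.Adj u v ↔ f u ≠ f v) := by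
  induction k generalizing S with
  | zero =>
    have hS : S = ∅ := by
      rw [eq_empty_iff_forall_notMem]
      intro v hv
      have : {v} ∈ cliquesIn G S (0 + 1) := by simp [mem_cliquesIn, hv]
      simp [hfree] at this
    subst hS
    refine ⟨fun _ => 0, by simp, ?_, by simp⟩
    simp [cliquesIn, card_filter_le_iff]
  | succ k ih =>
    rcases S.eq_empty_or_nonempty with rfl | hne
    · refine ⟨fun _ => 0, by simp, ?_, by simp⟩
      have : cliquesIn G ∅ (k + 1) = ∅ := by
        rw [eq_empty_iff_forall_notMem]
        intro Q hQ
        rw [mem_cliquesIn, subset_empty] at hQ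
        simp [hQ.1] at hQ
      simp [this]
    set N : V → Finset V := fun u => S.filter (G.Adj u) with hN
    -- Zykov's choice: v lies in the largest number of (k+1)-cliques. Its neighbourhood is coloured
    -- by induction, and its non-neighbours O, including v itself, form the new colour class k.
    obtain ⟨v, hv, hmax⟩ := exists_max_image S (fun u => #(cliquesIn G (N u) k)) hne
    obtain ⟨f', hf'k, hle, heq⟩ := ih (N v) (by
      rw [eq_empty_iff_forall_notMem]
      intro Q hQ
      have := insert_mem_cliquesIn hv hQ
      simp [hfree] at this)
    set O := S.filter fun u => ¬ G.Adj v u with hO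
    set f : V → ℕ := fun u => if G.Adj v u then f' u else k with hf
    have hvO : v ∈ O := by simp [hO, hv]
    have hfib : ∀ i ∈ range k, #(S.filter (f · = i)) = #((N v).filter (f' · = i)) := by
      intro i hi
      rw [mem_range] at hi
      congr 1
      ext u
      simp only [hf, hN, mem_filter]
      split_ifs with h
      · simp [h]
      · simp only [h, and_false, false_and, iff_false, not_and]
        omega
    have hlast : S.filter (f · = k) = O := by
      ext u
      simp only [hf, hO, mem_filter]
      refine and_congr_right fun hu => ?_
      split_ifs with h
      · have := hf'k u (by simp [hN, hu, h])
        simp only [h, not_true_eq_false, iff_false]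
        omega
      · simp [h]
    have hprod : ∏ i ∈ range (k + 1), #(S.filter (f · = i)) =
        (∏ i ∈ range k, #((N v).filter (f' · = i))) * #O := by
      rw [prod_range_succ, hlast, prod_congr rfl hfib]
    set p := ∏ i ∈ range k, #((N v).filter (f' · = i)) with hp
    set F : V → Finset (Finset V) := fun u => (cliquesIn G (N u) k).image (insert u) with hF
    have hFcard : ∀ u, #(F u) = #(cliquesIn G (N u) k) := by
      intro u
      refine card_image_of_injOn fun A hA B hB h => ?_
      have hu : ∀ A ∈ cliquesIn G (N u) k, u ∉ A := by
        intro A hA huA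
        have := (mem_cliquesIn.1 hA).1 huA
        simp [hN] at this
      have h : insert u A = insert u B := h
      rw [← erase_insert (hu A hA), ← erase_insert (hu B hB), h]
    -- A (k+1)-clique avoiding O would lie in the neighbourhood of v and extend to a (k+2)-clique.
    -- Thus each is counted at some vertex of O, and no vertex is in more of them than v.
    have hcov : cliquesIn G S (k + 1) ⊆ O.biUnion F := by
      intro Q hQ
      obtain ⟨u, huQ, huO⟩ : ∃ u ∈ Q, u ∈ O := by
        by_contra! hcon
        have hQN : Q ∈ cliquesIn G (N v) (k + 1) := by
          rw [mem_cliquesIn] at hQ ⊢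
          refine ⟨fun w hw => ?_, hQ.2⟩
          have h1 := hcon w hw
          have h2 := hQ.1 hw
          simp only [hO, hN, mem_filter, not_and, not_not] at h1 ⊢
          exact ⟨h2, h1 h2⟩
        have := insert_mem_cliquesIn hv hQN
        simp [hfree] at this
      exact mem_biUnion.2 ⟨u, huO, mem_image.2 ⟨_, erase_mem_cliquesIn huQ hQ, insert_erase huQ⟩⟩
    have hOS : ∀ u ∈ O, u ∈ S := fun u hu => (mem_filter.1 hu).1
    have s1 := card_le_card hcov
    have s2 : #(O.biUnion F) ≤ ∑ u ∈ O, #(F u) := card_biUnion_le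
    have s3' : ∀ u ∈ O, #(F u) ≤ #(cliquesIn G (N v) k) := fun u hu => by
      rw [hFcard]; exact hmax u (hOS u hu)
    have s3 : ∑ u ∈ O, #(F u) ≤ #O * #(cliquesIn G (N v) k) := by
      simpa using sum_le_card_nsmul O _ _ s3'
    have s4 : #O * #(cliquesIn G (N v) k) ≤ #O * p := Nat.mul_le_mul_left _ hle
    refine ⟨f, ?_, ?_, ?_⟩
    · intro u hu
      simp only [hf]
      split_ifs with h
      · have := hf'k u (by simp [hN, hu, h])
        omega
      · omega
    · rw [hprod, mul_comm]
      omega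
    -- Equality makes every inequality in the chain `s1`–`s4` tight. Positivity is essential, since
    -- 0 = 0 carries no structural information.
    intro hpos hQeq
    rw [hprod, mul_comm] at hQeq
    have hp_pos : 0 < p := by
      by_contra h0
      have : p = 0 := by omega
      rw [this, mul_zero] at hQeq
      omega
    have e4 : #(cliquesIn G (N v) k) = p :=
      Nat.eq_of_mul_eq_mul_left (card_pos.2 ⟨v, hvO⟩) (by omega)
    have hdpos : 0 < #(cliquesIn G (N v) k) := by omega
    have hadj := heq hdpos e4
    have hcardeq : ∀ u ∈ O, #(cliquesIn G (N u) k) = #(cliquesIn G (N v) k) := by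
      have h1 : ∑ u ∈ O, #(F u) = ∑ u ∈ O, #(cliquesIn G (N v) k) := by
        rw [sum_const, smul_eq_mul]; omega
      intro u hu
      rw [← hFcard]
      exact (sum_eq_sum_iff_of_le s3').1 h1 u hu
    -- If a k-clique Q in the neighbourhood of u contained another w in O, the clique Q ∪ {u} would
    -- be counted at both u and w, making the union bound strict.
    have hinN : ∀ u ∈ O, cliquesIn G (N u) k = cliquesIn G (N v) k := by
      intro u hu
      refine eq_of_subset_of_card_le (fun Q hQ => ?_) (hcardeq u hu).ge
      rw [mem_cliquesIn]
      refine ⟨fun w hw => ?_, (mem_cliquesIn.1 hQ).2⟩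
      have hwu : w ∈ N u := (mem_cliquesIn.1 hQ).1 hw
      simp only [hN, mem_filter] at hwu ⊢
      refine ⟨hwu.1, ?_⟩
      by_contra hvw
      have hwO : w ∈ O := by simp [hO, hwu.1, hvw]
      have hX := insert_mem_cliquesIn (hOS u hu) hQ
      have := card_biUnion_lt_sum (F := F) hu hwO (x := insert u Q) hwu.2.ne
        (mem_image_of_mem _ hQ) (mem_image.2 ⟨(insert u Q).erase w,
          erase_mem_cliquesIn (mem_insert_of_mem hw) hX, insert_erase (mem_insert_of_mem hw)⟩)
      omega
    have hOadj : ∀ u ∈ O, ∀ w ∈ N v, G.Adj u w := by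
      -- All colour classes in `N v` are nonempty, so w extends to a transversal. This is a k-clique
      -- in `N v`, hence also in `N u`, so u is adjacent to w.
      intro u hu w hw
      have hrep : ∀ i : Fin k, ∃ x, x ∈ N v ∧ f' x = i ∧ (f' w = i → x = w) := by
        intro i
        by_cases h : f' w = i
        · exact ⟨w, hw, h, fun _ => rfl⟩
        · have : #((N v).filter (f' · = i)) ≠ 0 :=
            (prod_ne_zero_iff.1 hp_pos.ne') i (mem_range.2 i.2)
          obtain ⟨x, hx⟩ := card_pos.1 (Nat.pos_of_ne_zero this)
          rw [mem_filter] at hx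
          exact ⟨x, hx.1, hx.2, fun h' => absurd h' h⟩
      choose g hg1 hg2 hg3 using hrep
      have hQ := image_mem_cliquesIn hadj fun i => ⟨hg1 i, hg2 i⟩
      rw [← hinN u hu] at hQ
      have hwQ : w ∈ univ.image g :=
        mem_image.2 ⟨⟨f' w, hf'k w hw⟩, mem_univ _, hg3 _ rfl⟩
      exact (mem_filter.1 ((mem_cliquesIn.1 hQ).1 hwQ)).2
    have hOind : ∀ u ∈ O, ∀ w ∈ O, ¬ G.Adj u w := by
      intro u hu w hw huw
      obtain ⟨Q, hQ⟩ := card_pos.1 hdpos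
      have h1 : insert w Q ∈ cliquesIn G (N u) (k + 1) := by
        have h2 : Q ∈ cliquesIn G ((N u).filter (G.Adj w)) k := by
          rw [mem_cliquesIn] at hQ ⊢
          refine ⟨fun x hx => ?_, hQ.2⟩
          have hxN := hQ.1 hx
          rw [mem_filter]
          exact ⟨mem_filter.2 ⟨(mem_filter.1 hxN).1, hOadj u hu x hxN⟩, hOadj w hw x hxN⟩
        exact insert_mem_cliquesIn (mem_filter.2 ⟨hOS w hw, huw⟩) h2
      have := insert_mem_cliquesIn (hOS u hu) h1
      simp [hfree] at this
    intro u hu w hw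
    by_cases h1 : G.Adj v u <;> by_cases h2 : G.Adj v w
    · simp only [hf, h1, h2, if_true]
      exact hadj u (mem_filter.2 ⟨hu, h1⟩) w (mem_filter.2 ⟨hw, h2⟩)
    · have h3 := hOadj w (mem_filter.2 ⟨hw, h2⟩) u (mem_filter.2 ⟨hu, h1⟩)
      have h4 := hf'k u (mem_filter.2 ⟨hu, h1⟩)
      simp only [hf, h1, h2, if_true, if_false, h3.symm, true_iff]
      omega
    · have h3 := hOadj u (mem_filter.2 ⟨hu, h1⟩) w (mem_filter.2 ⟨hw, h2⟩)
      have h4 := hf'k w (mem_filter.2 ⟨hw, h2⟩)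
      simp only [hf, h1, h2, if_true, if_false, h3, true_iff]
      omega
    · have h3 := hOind u (mem_filter.2 ⟨hu, h1⟩) w (mem_filter.2 ⟨hw, h2⟩)
      simp [hf, h1, h2, h3]

end CliqueCounting

/-! ### Maximal products with a given sum. -/

section BalancedProducts

open Finset
open scoped Classical

/-- The largest product of `k` natural numbers with sum `m`. -/
noncomputable def maxProd (k m : ℕ) : ℕ :=
  (piAntidiag (univ : Finset (Fin k)) m).sup fun g => ∏ i, g i

theorem prod_le_maxProd {k m : ℕ} {g : Fin k → ℕ} (hg : ∑ i, g i = m) :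
    ∏ i, g i ≤ maxProd k m :=
  le_sup (f := fun g : Fin k → ℕ => ∏ i, g i) (by simp [hg])

theorem exists_prod_eq_maxProd {k : ℕ} (hk : 1 ≤ k) (m : ℕ) :
    ∃ g : Fin k → ℕ, ∑ i, g i = m ∧ ∏ i, g i = maxProd k m := by
  have hne : (piAntidiag (univ : Finset (Fin k)) m).Nonempty :=
    ⟨fun i => if i = ⟨0, hk⟩ then m else 0, by simp⟩
  obtain ⟨g, hg, h⟩ := exists_mem_eq_sup _ hne fun g : Fin k → ℕ => ∏ i, g i
  exact ⟨g, by simpa using hg, h.symm⟩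

/-- Raising one factor g of an optimal product by 1 multiplies the product by (g+1)/g ≥ (m+1)/m, as
g ≤ m. This growth rate yields monotonicity, strict monotonicity and the gap estimate. -/
theorem succ_mul_maxProd_le {k : ℕ} (hk : 1 ≤ k) (m : ℕ) :
    (m + 1) * maxProd k m ≤ m * maxProd k (m + 1) := by
  obtain ⟨g, hg, hp⟩ := exists_prod_eq_maxProd hk m
  set i : Fin k := ⟨0, hk⟩
  have h1 : (g i + 1) * ∏ j ∈ univ.erase i, g j ≤ maxProd k (m + 1) := by
    have h2 : ∑ j, (Function.update g i (g i + 1)) j = m + 1 := by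
      rw [← add_sum_erase _ _ (mem_univ i), Function.update_self,
        sum_congr rfl fun j hj => Function.update_of_ne (ne_of_mem_erase hj) _ _, ← hg,
        ← add_sum_erase _ g (mem_univ i)]
      ring
    have h3 := prod_le_maxProd h2
    rwa [← mul_prod_erase _ _ (mem_univ i), Function.update_self,
      prod_congr rfl fun j hj => Function.update_of_ne (ne_of_mem_erase hj) _ _] at h3
  have h4 : g i ≤ m := hg ▸ single_le_sum (f := g) (fun _ _ => Nat.zero_le _) (mem_univ i)
  rw [← hp, ← mul_prod_erase _ g (mem_univ i)]
  refine le_trans ?_ (Nat.mul_le_mul_left m h1)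
  nlinarith [Nat.mul_le_mul_right (∏ j ∈ univ.erase i, g j) h4]

theorem maxProd_mono {k : ℕ} (hk : 1 ≤ k) : Monotone (maxProd k) := by
  refine monotone_nat_of_le_succ fun m => ?_
  rcases Nat.eq_zero_or_pos m with rfl | hm
  · have := succ_mul_maxProd_le hk 0
    omega
  · refine Nat.le_of_mul_le_mul_left ((Nat.mul_le_mul_right _ ?_).trans
      (succ_mul_maxProd_le hk m)) hm
    omega

theorem div_pow_le_maxProd {k : ℕ} (hk : 1 ≤ k) (m : ℕ) : (m / k) ^ k ≤ maxProd k m := by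
  have h1 : ∑ i : Fin k, (m / k + if i = ⟨0, hk⟩ then m % k else 0) = m := by
    rw [sum_add_distrib]
    simp [Nat.div_add_mod]
  refine le_trans ?_ (prod_le_maxProd h1)
  have := prod_le_prod' (s := univ) (f := fun _ : Fin k => m / k)
    (g := fun i : Fin k => m / k + if i = ⟨0, hk⟩ then m % k else 0)
    fun i _ => Nat.le_add_right _ _
  simpa using this

/-- Together with `pow_mul_maxProd_le` this pins `maxProd k m` to (m/k)^k up to lower order terms,
which is all that the stability argument needs. -/
theorem sub_pow_le_maxProd {k : ℕ} (hk : 1 ≤ k) (m : ℕ) :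
    (m - k) ^ k ≤ k ^ k * maxProd k m := by
  refine le_trans ?_ (Nat.mul_le_mul_left _ (div_pow_le_maxProd hk m))
  rw [← mul_pow]
  refine Nat.pow_le_pow_left ?_ k
  have h1 := Nat.div_add_mod m k
  have h2 := Nat.mod_lt m hk
  omega

theorem maxProd_pos {k m : ℕ} (hk : 1 ≤ k) (hm : k ≤ m) : 0 < maxProd k m :=
  (Nat.pow_pos (Nat.div_pos hm hk)).trans_le (div_pow_le_maxProd hk m)

theorem pow_mul_prod_le_sum_pow {k : ℕ} (hk : 1 ≤ k) (g : Fin k → ℕ) :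
    k ^ k * ∏ i, g i ≤ (∑ i, g i) ^ k := by
  have hk0 : (0 : ℝ) < k := by exact_mod_cast hk
  have h := Real.geom_mean_le_arith_mean univ (fun _ : Fin k => (1 : ℝ)) (fun i => (g i : ℝ))
    (by simp) (by simpa using hk0) (by simp)
  simp only [Real.rpow_one, sum_const, card_univ, Fintype.card_fin, nsmul_eq_mul, mul_one,
    one_mul] at h
  have hp : (0 : ℝ) ≤ ∏ i, (g i : ℝ) := prod_nonneg fun _ _ => Nat.cast_nonneg _
  have h2 := pow_le_pow_left₀ (Real.rpow_nonneg hp _) h k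
  rw [Real.rpow_inv_natCast_pow hp (by omega), div_pow, le_div_iff₀ (by positivity)] at h2
  have : ((k ^ k * ∏ i, g i : ℕ) : ℝ) ≤ (((∑ i, g i) ^ k : ℕ) : ℝ) := by
    push_cast
    linarith
  exact_mod_cast this

theorem pow_mul_maxProd_le {k : ℕ} (hk : 1 ≤ k) (m : ℕ) : k ^ k * maxProd k m ≤ m ^ k := by
  obtain ⟨g, hg, hp⟩ := exists_prod_eq_maxProd hk m
  rw [← hp, ← hg]
  exact pow_mul_prod_le_sum_pow hk g

/-- Factors with maximal positive product are balanced. -/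
theorem le_succ_of_prod_eq_maxProd {k m : ℕ} {g : Fin k → ℕ} (hg : ∑ i, g i = m)
    (hp : ∏ i, g i = maxProd k m) (hpos : 0 < ∏ i, g i) (i j : Fin k) : g i ≤ g j + 1 := by
  by_contra! hcon
  have hij : i ≠ j := by
    rintro rfl
    omega
  have hj : j ∈ (univ : Finset (Fin k)).erase i := mem_erase.2 ⟨hij.symm, mem_univ j⟩
  set R := ((univ : Finset (Fin k)).erase i).erase j with hR
  -- Moving one unit from i to j keeps the sum. When g i ≥ g j + 2, it strictly raises the product
  -- of these two factors.
  set g' : Fin k → ℕ := Function.update (Function.update g i (g i - 1)) j (g j + 1) with hg'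
  have h1 : g' i = g i - 1 := by simp [hg', hij]
  have h2 : g' j = g j + 1 := by simp [hg']
  have h3 : ∀ l ∈ R, g' l = g l := by
    intro l hl
    simp only [hR, mem_erase] at hl
    simp [hg', hl.1, hl.2.1]
  have hs : ∑ l, g' l = m := by
    rw [← add_sum_erase _ _ (mem_univ i), ← add_sum_erase _ _ hj, ← hR] at hg ⊢
    rw [sum_congr rfl h3, h1, h2]
    change g i + (g j + R.sum g) = m at hg
    change g i - 1 + (g j + 1 + R.sum g) = m
    omega
  have hle := prod_le_maxProd hs
  rw [← hp] at hle
  rw [← mul_prod_erase _ _ (mem_univ i), ← mul_prod_erase _ _ hj, ← hR] at hle hpos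
  rw [← mul_prod_erase _ g (mem_univ i), ← mul_prod_erase _ g hj, ← hR, prod_congr rfl h3, h1, h2,
    ← mul_assoc, ← mul_assoc] at hle
  have hRpos : 0 < ∏ l ∈ R, g l := by
    by_contra h0
    have h0 : ∏ l ∈ R, g l = 0 := by omega
    simp [h0] at hpos
  have := Nat.le_of_mul_le_mul_right hle hRpos
  obtain ⟨a, ha⟩ : ∃ a, g i = g j + 2 + a := ⟨g i - (g j + 2), by omega⟩
  rw [ha] at this
  have h4 : g j + 2 + a - 1 = g j + 1 + a := by omega
  rw [h4] at this
  nlinarith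

end BalancedProducts

/-! ### From extremal clique counts to Turán graphs. -/

section TuranCliques

open Finset
open scoped Classical

variable {V : Type*}

/-- The colour classes form an equipartition, and a part-preserving enumeration turns them into
residue classes modulo the number of parts. Nonemptiness of the classes makes that number exactly k.
-/
theorem nonempty_iso_turanGraph_of_balanced {G : SimpleGraph V} {S : Finset V} {k : ℕ}
    {f : V → ℕ} (hfk : ∀ v ∈ S, f v < k) (hf : ∀ u ∈ S, ∀ v ∈ S, G.Adj u v ↔ f u ≠ f v)
    (hpos : ∀ i < k, (S.filter (f · = i)).Nonempty)
    (hbal : ∀ i < k, ∀ j < k, #(S.filter (f · = i)) ≤ #(S.filter (f · = j)) + 1) :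
    Nonempty (G.induce (S : Set V) ≃g SimpleGraph.turanGraph #S k) := by
  have hex : ∀ a ∈ S, ∃! t ∈ (range k).image fun i => S.filter (f · = i), a ∈ t := by
    intro a ha
    refine ⟨S.filter (f · = f a), ⟨mem_image.2 ⟨f a, mem_range.2 (hfk a ha), rfl⟩,
      by simp [ha]⟩, ?_⟩
    rintro t ⟨ht, hat⟩
    obtain ⟨i, -, rfl⟩ := mem_image.1 ht
    rw [(mem_filter.1 hat).2]
  let P : Finpartition S := Finpartition.ofExistsUnique
    ((range k).image fun i => S.filter (f · = i))
    (by
      intro t ht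
      obtain ⟨i, -, rfl⟩ := mem_image.1 ht
      exact filter_subset _ _) hex (by
      intro h
      obtain ⟨i, hi, h⟩ := mem_image.1 h
      exact (hpos i (mem_range.1 hi)).ne_empty h)
  have hparts : P.parts = (range k).image fun i => S.filter (f · = i) := rfl
  have hcard : #P.parts = k := by
    rw [hparts, card_image_of_injOn, card_range]
    intro i hi j hj hij
    obtain ⟨x, hx⟩ := hpos i (by simpa using hi)
    have hx' : x ∈ S.filter (f · = j) := by
      rw [← show S.filter (f · = i) = S.filter (f · = j) from hij]
      exact hx
    rw [← (mem_filter.1 hx).2, ← (mem_filter.1 hx').2]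
  have hpart : ∀ a ∈ S, P.part a = S.filter (f · = f a) := fun a ha =>
    P.part_eq_of_mem (mem_image.2 ⟨f a, mem_range.2 (hfk a ha), rfl⟩) (by simp [ha])
  have heq : P.IsEquipartition := by
    intro a b ha hb
    rw [hparts] at ha hb
    obtain ⟨i, hi, rfl⟩ := mem_image.1 (mem_coe.1 ha)
    obtain ⟨j, hj, rfl⟩ := mem_image.1 (mem_coe.1 hb)
    exact hbal i (mem_range.1 hi) j (mem_range.1 hj)
  obtain ⟨e, he⟩ := heq.exists_partPreservingEquiv
  refine ⟨⟨e, ?_⟩⟩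
  intro a b
  have h1 := he a b
  rw [hcard, hpart a a.2, hpart b b.2] at h1
  rw [SimpleGraph.turanGraph_adj, Ne, ← h1, SimpleGraph.comap_adj]
  change _ ↔ G.Adj (a : V) b
  rw [hf a a.2 b b.2, not_iff_not]
  constructor
  · intro h
    have : (a : V) ∈ S.filter (f · = f b) := by
      rw [← h]
      exact mem_filter.2 ⟨a.2, rfl⟩
    exact (mem_filter.1 this).2
  · intro h
    rw [h]

theorem sum_card_fibers {S : Finset V} {k : ℕ} {f : V → ℕ} (hfk : ∀ v ∈ S, f v < k) :
    ∑ i : Fin k, #(S.filter (f · = i)) = #S := by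
  rw [← sum_range fun i => #(S.filter (f · = i))]
  exact (card_eq_sum_card_fiberwise fun v hv => mem_coe.2 (mem_range.2 (hfk v hv))).symm

/-- The number of `k`-cliques in a `K_{k+1}`-free graph. -/
theorem card_cliquesIn_le_maxProd {G : SimpleGraph V} {S : Finset V} {k : ℕ}
    (hfree : cliquesIn G S (k + 1) = ∅) : #(cliquesIn G S k) ≤ maxProd k #S := by
  obtain ⟨f, hfk, hle, -⟩ := exists_coloring_card_cliquesIn_le G k S hfree
  refine hle.trans ?_
  rw [prod_range]
  exact prod_le_maxProd (sum_card_fibers hfk)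

theorem nonempty_iso_turanGraph_of_prod_eq {G : SimpleGraph V} {S : Finset V} {k : ℕ}
    (hk : 1 ≤ k) (hS : k ≤ #S) {f : V → ℕ} (hfk : ∀ v ∈ S, f v < k)
    (hf : ∀ u ∈ S, ∀ v ∈ S, G.Adj u v ↔ f u ≠ f v)
    (hp : ∏ i ∈ range k, #(S.filter (f · = i)) = maxProd k #S) :
    Nonempty (G.induce (S : Set V) ≃g SimpleGraph.turanGraph #S k) := by
  have hpos := maxProd_pos hk hS
  rw [← hp] at hpos
  refine nonempty_iso_turanGraph_of_balanced hfk hf (fun i hi => card_pos.1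
    (Nat.pos_of_ne_zero (prod_ne_zero_iff.1 hpos.ne' i (mem_range.2 hi)))) fun i hi j hj => ?_
  rw [prod_range] at hp hpos
  exact le_succ_of_prod_eq_maxProd (sum_card_fibers hfk) hp hpos ⟨i, hi⟩ ⟨j, hj⟩

theorem nonempty_iso_turanGraph_of_card_cliquesIn {G : SimpleGraph V} {S : Finset V} {k : ℕ}
    (hk : 1 ≤ k) (hS : k ≤ #S) (hfree : cliquesIn G S (k + 1) = ∅)
    (hcard : maxProd k #S ≤ #(cliquesIn G S k)) :
    Nonempty (G.induce (S : Set V) ≃g SimpleGraph.turanGraph #S k) := by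
  obtain ⟨f, hfk, hle, heq⟩ := exists_coloring_card_cliquesIn_le G k S hfree
  have hp : ∏ i ∈ range k, #(S.filter (f · = i)) ≤ maxProd k #S := by
    rw [prod_range]
    exact prod_le_maxProd (sum_card_fibers hfk)
  have := maxProd_pos hk hS
  exact nonempty_iso_turanGraph_of_prod_eq hk hS hfk
    (heq (by omega) (by omega)) (by omega)

theorem card_cliquesIn_le_of_iso {W : Type*} [Fintype V] [Fintype W] {G : SimpleGraph V}
    {H : SimpleGraph W} (e : G ≃g H) (k : ℕ) :
    #(cliquesIn G univ k) ≤ #(cliquesIn H univ k) := by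
  refine card_le_card_of_injOn (fun Q => Q.map e.toEquiv.toEmbedding) ?_
    (map_injective _).injOn
  intro Q hQ
  obtain ⟨-, hQk, hQc⟩ := mem_cliquesIn.1 (mem_coe.1 hQ)
  refine mem_coe.2 (mem_cliquesIn.2 ⟨subset_univ _, by rw [card_map, hQk], ?_⟩)
  intro y hy z hz hyz
  obtain ⟨a, ha, rfl⟩ := mem_map.1 (mem_coe.1 hy)
  obtain ⟨b, hb, rfl⟩ := mem_map.1 (mem_coe.1 hz)
  exact e.map_adj_iff.2 (hQc ha hb fun h => hyz (by rw [h]))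

theorem card_cliquesIn_eq_of_iso {W : Type*} [Fintype V] [Fintype W] {G : SimpleGraph V}
    {H : SimpleGraph W} (e : G ≃g H) (k : ℕ) :
    #(cliquesIn G univ k) = #(cliquesIn H univ k) :=
  le_antisymm (card_cliquesIn_le_of_iso e k) (card_cliquesIn_le_of_iso e.symm k)

/-- No part sizes of the Turán graph are computed: a complete multipartite graph whose part sizes
attain the maximal product is balanced, hence isomorphic to the Turán graph, and its transversals
are k-cliques. -/
theorem card_cliquesIn_turanGraph {k m : ℕ} (hk : 1 ≤ k) (hm : k ≤ m) :
    #(cliquesIn (SimpleGraph.turanGraph m k) univ k) = maxProd k m := by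
  refine le_antisymm ?_ ?_
  · have h : cliquesIn (SimpleGraph.turanGraph m k) univ (k + 1) = ∅ := by
      rw [eq_empty_iff_forall_notMem]
      intro Q hQ
      obtain ⟨-, hQk, hQc⟩ := mem_cliquesIn.1 hQ
      exact SimpleGraph.turanGraph_cliqueFree hk Q ⟨hQc, hQk⟩
    simpa using card_cliquesIn_le_maxProd h
  · obtain ⟨g, hg, hp⟩ := exists_prod_eq_maxProd hk m
    let G := SimpleGraph.completeMultipartiteGraph fun i : Fin k => Fin (g i)
    let f : (Σ i : Fin k, Fin (g i)) → ℕ := fun x => x.1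
    have hcard : #(univ : Finset (Σ i : Fin k, Fin (g i))) = m := by simp [hg]
    have hf : ∀ u ∈ (univ : Finset (Σ i : Fin k, Fin (g i))),
        ∀ v ∈ (univ : Finset (Σ i : Fin k, Fin (g i))), G.Adj u v ↔ f u ≠ f v := by
      intro u _ v _
      simp [G, f, Fin.ext_iff]
    have hfib : ∀ i : Fin k, #((univ : Finset (Σ i : Fin k, Fin (g i))).filter (f · = i)) = g i := by
      intro i
      have : (univ : Finset (Σ i : Fin k, Fin (g i))).filter (f · = i) =
          (univ : Finset (Fin (g i))).map (Function.Embedding.sigmaMk i) := by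
        ext ⟨a, b⟩
        simp only [f, mem_filter, mem_univ, true_and, mem_map, Function.Embedding.sigmaMk_apply]
        constructor
        · intro h
          obtain rfl := Fin.ext h
          exact ⟨b, rfl⟩
        · rintro ⟨c, hc⟩
          exact (congrArg (fun x => (x.1 : ℕ)) hc).symm
      rw [this, card_map, card_univ, Fintype.card_fin]
    have hprod : ∏ i ∈ range k, #((univ : Finset (Σ i : Fin k, Fin (g i))).filter (f · = i)) =
        maxProd k m := by
      rw [prod_range, ← hp]
      exact prod_congr rfl fun i _ => hfib i
    obtain ⟨e⟩ := nonempty_iso_turanGraph_of_prod_eq (S := univ) hk (by rwa [hcard])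
      (fun v _ => v.1.2) hf (by rw [hprod, hcard])
    rw [coe_univ, hcard] at e
    rw [← card_cliquesIn_eq_of_iso ((SimpleGraph.induceUnivIso G).symm.trans e), ← hprod]
    exact prod_card_le_card_cliquesIn hf

end TuranCliques

/-! ### Copies as cliques, and `twoCliques r 1` as an intersection condition. -/

section Copies

open Finset
open scoped Classical

variable {V : Type*}

theorem subgraph_adj_iff_of_iso_top {U : Type*} {G : SimpleGraph V} {G' : G.Subgraph}
    (e : SimpleGraph.completeGraph U ≃g G'.coe) {u v : V} :
    G'.Adj u v ↔ u ∈ G'.verts ∧ v ∈ G'.verts ∧ u ≠ v := by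
  constructor
  · intro h
    exact ⟨G'.edge_vert h, G'.edge_vert h.symm, h.ne⟩
  · rintro ⟨hu, hv, huv⟩
    have h1 : (SimpleGraph.completeGraph U).Adj (e.symm ⟨u, hu⟩) (e.symm ⟨v, hv⟩) := by
      intro h
      exact huv (congrArg Subtype.val (e.symm.injective h))
    have h2 := e.map_adj_iff.2 h1
    simpa using h2

variable [Fintype V]

/-- A subgraph isomorphic to a complete graph has every edge between its vertices, so it is
determined by its vertex set. -/
theorem copyCount_completeGraph (G : SimpleGraph V) (r : ℕ) :
    G.copyCount (SimpleGraph.completeGraph (Fin r)) = #(cliquesIn G univ r) := by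
  rw [SimpleGraph.copyCount]
  refine card_bij (fun G' _ => G'.verts.toFinset) ?_ ?_ ?_
  · intro G' hG'
    obtain ⟨e⟩ := (mem_filter.1 hG').2
    refine mem_cliquesIn.2 ⟨subset_univ _, ?_, ?_⟩
    · rw [Set.toFinset_card, ← Fintype.card_congr e.toEquiv, Fintype.card_fin]
    · intro u hu v hv huv
      rw [Set.coe_toFinset] at hu hv
      exact ((subgraph_adj_iff_of_iso_top e).2 ⟨hu, hv, huv⟩).adj_sub
  · intro G' hG' G'' hG'' h
    obtain ⟨e⟩ := (mem_filter.1 hG').2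
    obtain ⟨e'⟩ := (mem_filter.1 hG'').2
    have hv : G'.verts = G''.verts := Set.toFinset_inj.1 h
    refine SimpleGraph.Subgraph.ext hv ?_
    ext u v
    rw [subgraph_adj_iff_of_iso_top e, subgraph_adj_iff_of_iso_top e', hv]
  · intro Q hQ
    obtain ⟨-, hQr, hQc⟩ := mem_cliquesIn.1 hQ
    refine ⟨(⊤ : G.Subgraph).induce (Q : Set V), mem_filter.2 ⟨mem_univ _, ?_⟩, by simp⟩
    let e : Fin r ≃ (Q : Set V) := (Q.equivFinOfCardEq hQr).symm
    refine ⟨⟨e, ?_⟩⟩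
    intro a b
    have ha : (e a : V) ∈ (Q : Set V) := (e a).2
    have hb : (e b : V) ∈ (Q : Set V) := (e b).2
    change ((⊤ : G.Subgraph).induce (Q : Set V)).Adj (e a : V) (e b : V) ↔ a ≠ b
    rw [SimpleGraph.Subgraph.induce_adj]
    constructor
    · rintro ⟨-, -, h⟩ rfl
      exact h.ne rfl
    · intro h
      exact ⟨ha, hb, hQc ha hb fun h' => h (e.injective (Subtype.ext h'))⟩

theorem card_inter_ne_one_of_free [DecidableEq V] {G : SimpleGraph V} {r : ℕ} (hr : 1 ≤ r)
    (h : (twoCliques r 1).Free G) {A B : Finset V} (hA : A ∈ cliquesIn G univ r)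
    (hB : B ∈ cliquesIn G univ r) : #(A ∩ B) ≠ 1 := by
  intro hone
  obtain ⟨x, hx⟩ := card_eq_one.1 hone
  obtain ⟨-, hAr, hAc⟩ := mem_cliquesIn.1 hA
  obtain ⟨-, hBr, hBc⟩ := mem_cliquesIn.1 hB
  have hxAB : x ∈ A ∩ B := by simp [hx]
  rw [mem_inter] at hxAB
  have eA := ((A.erase x).equivFinOfCardEq
    (by rw [card_erase_of_mem hxAB.1, hAr] : #(A.erase x) = r - 1)).symm
  have eB := ((B.erase x).equivFinOfCardEq
    (by rw [card_erase_of_mem hxAB.2, hBr] : #(B.erase x) = r - 1)).symm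
  have hAm : ∀ i, (eA i : V) ∈ A ∧ (eA i : V) ≠ x := fun i =>
    ⟨mem_of_mem_erase (eA i).2, ne_of_mem_erase (eA i).2⟩
  have hBm : ∀ i, (eB i : V) ∈ B ∧ (eB i : V) ≠ x := fun i =>
    ⟨mem_of_mem_erase (eB i).2, ne_of_mem_erase (eB i).2⟩
  have hcross : ∀ i j, (eA i : V) ≠ eB j := by
    intro i j h
    have : (eA i : V) ∈ A ∩ B := mem_inter.2 ⟨(hAm i).1, h ▸ (hBm j).1⟩
    rw [hx, mem_singleton] at this
    exact (hAm i).2 this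
  -- The first r - 1 indices enumerate A without x, index r - 1 is the shared vertex x, and the rest
  -- enumerate B without x.
  let φ : Fin (2 * r - 1) → V := fun i =>
    if h : i.val < r - 1 then eA ⟨i, h⟩
    else if h' : r ≤ i.val then eB ⟨i - r, by omega⟩ else x
  have hinj : Function.Injective φ := by
    intro i j hij
    simp only [φ] at hij
    split_ifs at hij with h1 h2 h3 h4 h5 h6 h7 h8
    · have := congrArg Fin.val (eA.injective (Subtype.ext hij))
      exact Fin.ext this
    · exact absurd hij (hcross _ _)
    · exact absurd hij (hAm _).2
    · exact absurd hij.symm (hcross _ _)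
    · have := congrArg Fin.val (eB.injective (Subtype.ext hij))
      simp only at this
      exact Fin.ext (by omega)
    · exact absurd hij (hBm _).2
    · exact absurd hij.symm (hAm _).2
    · exact absurd hij.symm (hBm _).2
    · exact Fin.ext (by omega)
  have hφA : ∀ i : Fin (2 * r - 1), i.val < r → φ i ∈ A := by
    intro i hi
    simp only [φ]
    split_ifs with h1 h2
    · exact (hAm _).1
    · omega
    · exact hxAB.1
  have hφB : ∀ i : Fin (2 * r - 1), r - 1 ≤ i.val → φ i ∈ B := by
    intro i hi
    simp only [φ]
    split_ifs with h1 h2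
    · omega
    · exact (hBm _).1
    · exact hxAB.2
  refine h ⟨⟨⟨φ, ?_⟩, hinj⟩⟩
  rintro i j ⟨hij, ⟨hi, hj⟩ | ⟨hi, hj⟩⟩
  · exact hAc (hφA i hi) (hφA j hj) (hinj.ne hij)
  · exact hBc (hφB i hi) (hφB j hj) (hinj.ne hij)

theorem free_of_card_inter_ne_one [DecidableEq V] {G : SimpleGraph V} {r : ℕ} (hr : 1 ≤ r)
    (h : ∀ A ∈ cliquesIn G univ r, ∀ B ∈ cliquesIn G univ r, #(A ∩ B) ≠ 1) :
    (twoCliques r 1).Free G := by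
  rintro ⟨f⟩
  have hinj : Function.Injective (f : Fin (2 * r - 1) → V) := f.injective
  have hclique : ∀ I : Finset (Fin (2 * r - 1)), #I = r →
      (∀ i ∈ I, ∀ j ∈ I, i ≠ j → (twoCliques r 1).Adj i j) →
      I.image f ∈ cliquesIn G univ r := by
    intro I hI hadj
    refine mem_cliquesIn.2 ⟨subset_univ _, by rw [card_image_of_injective _ hinj, hI], ?_⟩
    intro u hu v hv huv
    obtain ⟨i, hi, rfl⟩ := mem_image.1 (mem_coe.1 hu)
    obtain ⟨j, hj, rfl⟩ := mem_image.1 (mem_coe.1 hv)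
    exact f.toHom.map_adj (hadj i hi j hj fun h => huv (by rw [h]))
  have hI : #(univ.filter fun i : Fin (2 * r - 1) => i.val < r) = r := by
    rw [Fin.card_filter_val_lt]
    omega
  have hJ : #(univ.filter fun i : Fin (2 * r - 1) => r - 1 ≤ i.val) = r := by
    have h1 := card_filter_add_card_filter_not (s := (univ : Finset (Fin (2 * r - 1))))
      (fun i => i.val < r - 1)
    rw [Fin.card_filter_val_lt] at h1
    simp only [not_lt, card_univ, Fintype.card_fin] at h1
    omega
  refine h _ (hclique _ hI ?_) _ (hclique _ hJ ?_) ?_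
  · intro i hi j hj hij
    exact ⟨hij, .inl ⟨(mem_filter.1 hi).2, (mem_filter.1 hj).2⟩⟩
  · intro i hi j hj hij
    exact ⟨hij, .inr ⟨(mem_filter.1 hi).2, (mem_filter.1 hj).2⟩⟩
  · rw [← image_inter _ _ hinj, card_image_of_injective _ hinj, card_eq_one]
    refine ⟨⟨r - 1, by omega⟩, ?_⟩
    ext i
    simp only [mem_inter, mem_filter, mem_univ, true_and, mem_singleton, Fin.ext_iff]
    omega

end Copies

/-! ### The extremal construction. -/

section Join

open Finset
open scoped Classical

/-- The Turán side is K_{k+1}-free and so contributes at most k vertices; the other two must be both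
vertices of `K_2`. -/
theorem two_le_card_inter_join {k m : ℕ} (hk : 1 ≤ k) {Q : Finset (Fin 2 ⊕ Fin m)}
    (hQ : Q ∈ cliquesIn (graphJoin (SimpleGraph.completeGraph (Fin 2))
      (SimpleGraph.turanGraph m k)) univ (k + 2)) : (univ : Finset (Fin 2)).map .inl ⊆ Q := by
  obtain ⟨-, hQk, hQc⟩ := mem_cliquesIn.1 hQ
  have hR : #Q.toRight ≤ k := by
    by_contra! hcon
    obtain ⟨T, hT, hTk⟩ := exists_subset_card_eq hcon
    refine SimpleGraph.turanGraph_cliqueFree (n := m) hk T ⟨?_, hTk⟩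
    intro u hu v hv huv
    have := hQc (mem_toRight.1 (hT hu)) (mem_toRight.1 (hT hv)) (by simpa using huv)
    simpa [graphJoin] using this
  have h1 := Q.card_toLeft_add_card_toRight
  have h2 : Q.toLeft = univ := by
    rw [← card_eq_iff_eq_univ, Fintype.card_fin]
    have := card_le_univ Q.toLeft
    rw [Fintype.card_fin] at this
    omega
  intro x hx
  obtain ⟨i, -, rfl⟩ := mem_map.1 hx
  exact mem_toLeft.1 (h2 ▸ mem_univ i)

theorem card_inter_ne_one_join {k m : ℕ} (hk : 1 ≤ k) :
    ∀ A ∈ cliquesIn (graphJoin (SimpleGraph.completeGraph (Fin 2))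
      (SimpleGraph.turanGraph m k)) univ (k + 2),
    ∀ B ∈ cliquesIn (graphJoin (SimpleGraph.completeGraph (Fin 2))
      (SimpleGraph.turanGraph m k)) univ (k + 2), #(A ∩ B) ≠ 1 := by
  intro A hA B hB
  have := card_le_card (subset_inter (two_le_card_inter_join hk hA)
    (two_le_card_inter_join hk hB))
  rw [card_map, card_univ, Fintype.card_fin] at this
  omega

theorem card_cliquesIn_turanGraph_le_join (k m : ℕ) :
    #(cliquesIn (SimpleGraph.turanGraph m k) univ k) ≤
      #(cliquesIn (graphJoin (SimpleGraph.completeGraph (Fin 2))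
        (SimpleGraph.turanGraph m k)) univ (k + 2)) := by
  refine card_le_card_of_injOn (fun Q => (univ : Finset (Fin 2)).disjSum Q) ?_ ?_
  · intro Q hQ
    obtain ⟨-, hQk, hQc⟩ := mem_cliquesIn.1 (mem_coe.1 hQ)
    refine mem_coe.2 (mem_cliquesIn.2 ⟨subset_univ _, by simp [card_disjSum, hQk, add_comm], ?_⟩)
    rintro (u | u) hu (v | v) hv huv
    · simpa [graphJoin] using huv
    · simp [graphJoin]
    · simp [graphJoin]
    · have := hQc (inr_mem_disjSum.1 (mem_coe.1 hu)) (inr_mem_disjSum.1 (mem_coe.1 hv))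
        (by simpa using huv)
      simpa [graphJoin] using this
  · intro Q _ Q' _ h
    have h : (univ : Finset (Fin 2)).disjSum Q = (univ : Finset (Fin 2)).disjSum Q' := h
    ext x
    rw [← inr_mem_disjSum (s := (univ : Finset (Fin 2))), h, inr_mem_disjSum]

end Join

/-! ### Stability: one dominant kernel pair, then exactness. -/

section Stability

open Finset
open scoped Classical

variable {V : Type*}

/-- A Bernoulli-type bound for truncated subtraction: bounded shifts of n cost only order n^(k-1).
-/
theorem pow_le_sub_pow_add (n c k : ℕ) : n ^ k ≤ (n - c) ^ k + c * k * n ^ (k - 1) := by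
  induction k with
  | zero => simp
  | succ k ih =>
    have h1 : n * (n - c) ^ k ≤ (n - c) ^ (k + 1) + c * n ^ k := by
      calc n * (n - c) ^ k ≤ ((n - c) + c) * (n - c) ^ k := Nat.mul_le_mul_right _ (by omega)
        _ = (n - c) ^ (k + 1) + c * (n - c) ^ k := by ring
        _ ≤ _ := by
          have := Nat.pow_le_pow_left (Nat.sub_le n c) k
          gcongr
    have h2 : n * (c * k * n ^ (k - 1)) = c * k * n ^ k := by
      rcases Nat.eq_zero_or_pos k with rfl | hk
      · simp
      · obtain ⟨l, rfl⟩ : ∃ l, k = l + 1 := ⟨k - 1, by omega⟩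
        rw [Nat.add_sub_cancel]
        ring
    calc n ^ (k + 1) = n * n ^ k := by ring
      _ ≤ n * ((n - c) ^ k + c * k * n ^ (k - 1)) := Nat.mul_le_mul_left _ ih
      _ = n * (n - c) ^ k + c * k * n ^ k := by rw [mul_add, h2]
      _ ≤ (n - c) ^ (k + 1) + c * n ^ k + c * k * n ^ k := Nat.add_le_add_right h1 _
      _ = _ := by
        rw [Nat.add_sub_cancel]
        ring

theorem maxProd_lt_succ {k m : ℕ} (hk : 1 ≤ k) (hm : k ≤ m + 1) :
    maxProd k m < maxProd k (m + 1) := by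
  have h1 := maxProd_pos hk hm
  have h2 := succ_mul_maxProd_le hk m
  by_contra! h3
  have h4 := Nat.mul_le_mul_left m h3
  nlinarith

theorem Kern.subset_of_not_disjoint {𝓕 : Finset (Finset V)} {r : ℕ} (h𝓕 : ∀ F ∈ 𝓕, #F = r)
    (hint : ∀ F ∈ 𝓕, ∀ F' ∈ 𝓕, #(F ∩ F') ≠ 1) {P L : Finset V} (hP : Kern 𝓕 (r + 1) P)
    (hP2 : #P = 2) (hL : Kern 𝓕 (r + 1) L) (hd : ¬ Disjoint L P) : P ⊆ L := by
  have h1 := hL.card_inter_ne_one h𝓕 hint hP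
  have h2 : 0 < #(L ∩ P) := by
    rw [card_pos, nonempty_iff_ne_empty, Ne, ← disjoint_iff_inter_eq_empty]
    exact hd
  have h3 : L ∩ P = P := eq_of_subset_of_card_le inter_subset_right (by omega)
  rw [← h3]
  exact inter_subset_left

variable [Fintype V]

/-- The vertices extending `P` to a member of `Kern 𝓕 t`. -/
noncomputable def petal (𝓕 : Finset (Finset V)) (t : ℕ) (P : Finset V) : Finset V :=
  univ.filter fun x => x ∉ P ∧ Kern 𝓕 t (insert x P)

theorem mem_petal {𝓕 : Finset (Finset V)} {t : ℕ} {P : Finset V} {x : V} :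
    x ∈ petal 𝓕 t P ↔ x ∉ P ∧ Kern 𝓕 t (insert x P) := by
  simp [petal]

/-- The pairs in `Kern 𝓕 t`. -/
noncomputable def kernPairs (𝓕 : Finset (Finset V)) (t : ℕ) : Finset (Finset V) :=
  univ.filter fun P => #P = 2 ∧ Kern 𝓕 t P

theorem mem_kernPairs {𝓕 : Finset (Finset V)} {t : ℕ} {P : Finset V} :
    P ∈ kernPairs 𝓕 t ↔ #P = 2 ∧ Kern 𝓕 t P := by
  simp [kernPairs]

/-- A member meeting the pair P cannot do so in one point. A member disjoint from P but containing a
petal vertex x would meet the kernel P ∪ {x} in x alone. -/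
theorem subset_of_mem_petal {𝓕 : Finset (Finset V)} {r : ℕ} (h𝓕 : ∀ F ∈ 𝓕, #F = r)
    (hint : ∀ F ∈ 𝓕, ∀ F' ∈ 𝓕, #(F ∩ F') ≠ 1) {P F : Finset V}
    (hP : P ∈ kernPairs 𝓕 (r + 1)) (hF : F ∈ 𝓕) {x : V}
    (hx : x ∈ P ∪ petal 𝓕 (r + 1) P) (hxF : x ∈ F) : P ⊆ F := by
  rw [mem_kernPairs] at hP
  refine hP.2.subset_of_not_disjoint h𝓕 hint hP.1 (.base F hF) fun hd => ?_
  rw [mem_union] at hx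
  rcases hx with hx | hx
  · exact disjoint_left.1 hd hxF hx
  · rw [mem_petal] at hx
    refine (Kern.base (t := r + 1) F hF).card_inter_ne_one h𝓕 hint hx.2 ?_
    rw [inter_insert_of_mem hxF, disjoint_iff_inter_eq_empty.1 hd]
    simp

/-- Distinct kernel pairs P, P' are disjoint, so a vertex x in both petals would be the only common
point of the kernels P ∪ {x} and P' ∪ {x}. -/
theorem sum_card_petal_le {𝓕 : Finset (Finset V)} {r : ℕ} (h𝓕 : ∀ F ∈ 𝓕, #F = r)
    (hint : ∀ F ∈ 𝓕, ∀ F' ∈ 𝓕, #(F ∩ F') ≠ 1) :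
    ∑ P ∈ kernPairs 𝓕 (r + 1), #(petal 𝓕 (r + 1) P) ≤ Fintype.card V := by
  rw [← card_biUnion]
  · exact card_le_univ _
  intro P hP P' hP' hne
  rw [mem_coe, mem_kernPairs] at hP hP'
  have hd : Disjoint P P' := by
    by_contra hd
    exact hne (eq_of_subset_of_card_le (hP.2.subset_of_not_disjoint h𝓕 hint hP.1 hP'.2
      fun h => hd h.symm) (by omega))
  refine disjoint_left.2 ?_
  intro x hx hx'
  rw [mem_petal] at hx hx'
  refine hx.2.card_inter_ne_one h𝓕 hint hx'.2 ?_
  rw [← insert_inter_distrib, disjoint_iff_inter_eq_empty.1 hd]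
  simp

/-- The common neighbours of the vertices of `P`. -/
noncomputable def commonNbhd (G : SimpleGraph V) (P : Finset V) : Finset V :=
  univ.filter fun x => ∀ a ∈ P, G.Adj a x

theorem mem_commonNbhd {G : SimpleGraph V} {P : Finset V} {x : V} :
    x ∈ commonNbhd G P ↔ ∀ a ∈ P, G.Adj a x := by
  simp [commonNbhd]

/-- A (k+1)-clique in the common neighbourhood, joined with one vertex of P, would be a member of
the family meeting the kernel P only there. -/
theorem cliquesIn_commonNbhd_eq_empty {G : SimpleGraph V} {k : ℕ}
    (hint : ∀ A ∈ cliquesIn G univ (k + 2), ∀ B ∈ cliquesIn G univ (k + 2), #(A ∩ B) ≠ 1)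
    {P : Finset V} (hP : P ∈ kernPairs (cliquesIn G univ (k + 2)) (k + 2 + 1)) :
    cliquesIn G (commonNbhd G P) (k + 1) = ∅ := by
  rw [eq_empty_iff_forall_notMem]
  intro Q hQ
  obtain ⟨a, ha, b, hb, hab⟩ := one_lt_card.1 (by rw [(mem_kernPairs.1 hP).1]; omega : 1 < #P)
  have hQS := (mem_cliquesIn.1 hQ).1
  have h1 : insert a Q ∈ cliquesIn G univ (k + 2) := by
    refine insert_mem_cliquesIn (mem_univ a) (mem_cliquesIn.2 ⟨fun x hx => ?_,
      (mem_cliquesIn.1 hQ).2⟩)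
    exact mem_filter.2 ⟨mem_univ x, mem_commonNbhd.1 (hQS hx) a ha⟩
  have h2 := subset_of_mem_petal (fun F hF => (mem_cliquesIn.1 hF).2.1) hint hP h1
    (mem_union_left _ ha) (mem_insert_self a Q) hb
  rw [mem_insert] at h2
  rcases h2 with h2 | h2
  · exact hab h2.symm
  · exact G.irrefl (mem_commonNbhd.1 (hQS h2) b hb)

theorem card_filter_pair_le {G : SimpleGraph V} {k : ℕ} {P T : Finset V} (hP2 : #P = 2) :
    #((cliquesIn G univ (k + 2)).filter fun F => P ⊆ F ∧ F \ P ⊆ T) ≤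
      #(cliquesIn G (commonNbhd G P ∩ T) k) := by
  refine card_le_card_of_injOn (· \ P) ?_ ?_
  · intro F hF
    obtain ⟨hF, hPF, hFT⟩ := mem_filter.1 (mem_coe.1 hF)
    obtain ⟨-, hFk, hFc⟩ := mem_cliquesIn.1 hF
    refine mem_coe.2 (mem_cliquesIn.2 ⟨subset_inter ?_ hFT, ?_, hFc.subset (by simp)⟩)
    · intro x hx
      rw [mem_sdiff] at hx
      exact mem_commonNbhd.2 fun a ha => hFc (hPF ha) hx.1 fun h => hx.2 (h ▸ ha)
    · rw [card_sdiff_of_subset hPF, hFk, hP2]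
      omega
  · intro F hF F' hF' h
    have h1 := (mem_filter.1 (mem_coe.1 hF)).2.1
    have h2 := (mem_filter.1 (mem_coe.1 hF')).2.1
    have h : F \ P = F' \ P := h
    rw [← sdiff_union_of_subset h1, ← sdiff_union_of_subset h2, h]

theorem card_filter_pair_le_maxProd {G : SimpleGraph V} {k : ℕ} (hk : 1 ≤ k)
    (hint : ∀ A ∈ cliquesIn G univ (k + 2), ∀ B ∈ cliquesIn G univ (k + 2), #(A ∩ B) ≠ 1)
    {P T : Finset V} (hP : P ∈ kernPairs (cliquesIn G univ (k + 2)) (k + 2 + 1)) {m : ℕ}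
    (hm : #(commonNbhd G P ∩ T) ≤ m) :
    #((cliquesIn G univ (k + 2)).filter fun F => P ⊆ F ∧ F \ P ⊆ T) ≤ maxProd k m := by
  refine ((card_filter_pair_le (mem_kernPairs.1 hP).1).trans
    (card_cliquesIn_le_maxProd ?_)).trans (maxProd_mono hk hm)
  rw [← subset_empty, ← cliquesIn_commonNbhd_eq_empty hint hP]
  exact cliquesIn_mono G inter_subset_left _

/-- The error constant in `exists_large_petal`. -/
def petalDefect (k : ℕ) : ℕ :=
  k ^ k * ((k + 2) * 2 ^ ((k + 2) * sunflowerBound (k + 2 + 1) (k + 2))) + (2 + k) * k + 1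

/-- If every petal missed more than `petalDefect k` vertices, the sum of their k-th powers would
fall short of n^k by too much. In the constant, the first summand absorbs the O(n^(k-1)) bad
cliques, (2 + k)k pays for replacing (n - 2 - k)^k by n^k, and 1 makes the contradiction strict. -/
theorem exists_large_petal {G : SimpleGraph V} {k : ℕ} (hk : 3 ≤ k)
    (hint : ∀ A ∈ cliquesIn G univ (k + 2), ∀ B ∈ cliquesIn G univ (k + 2), #(A ∩ B) ≠ 1)
    (hn : petalDefect k ≤ Fintype.card V)
    (hcard : maxProd k (Fintype.card V - 2) ≤ #(cliquesIn G univ (k + 2))) :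
    ∃ P ∈ kernPairs (cliquesIn G univ (k + 2)) (k + 2 + 1),
      Fintype.card V ≤ #(petal (cliquesIn G univ (k + 2)) (k + 2 + 1) P) + petalDefect k := by
  by_contra! hcon
  set 𝓕 := cliquesIn G univ (k + 2)
  set n := Fintype.card V
  set C := (k + 2) * 2 ^ ((k + 2) * sunflowerBound (k + 2 + 1) (k + 2)) with hC
  have h𝓕 : ∀ F ∈ 𝓕, #F = k + 2 := fun F hF => (mem_cliquesIn.1 hF).2.1
  have hcov : 𝓕 ⊆ (𝓕.filter fun F => ∃ W ⊆ F, #W + 3 ≤ #(kernelHull 𝓕 (k + 2 + 1) F W)) ∪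
      (kernPairs 𝓕 (k + 2 + 1)).biUnion fun P =>
        𝓕.filter fun F => P ⊆ F ∧ F \ P ⊆ petal 𝓕 (k + 2 + 1) P := by
    intro F hF
    rw [mem_union]
    by_cases hbad : ∃ W ⊆ F, #W + 3 ≤ #(kernelHull 𝓕 (k + 2 + 1) F W)
    · exact .inl (mem_filter.2 ⟨hF, hbad⟩)
    · push Not at hbad
      obtain ⟨P, hP2, hP, hPF, hPx⟩ := exists_kern_pair h𝓕 (by omega) hint hF hbad
      refine .inr (mem_biUnion.2 ⟨P, mem_kernPairs.2 ⟨hP2, hP⟩, mem_filter.2 ⟨hF, hPF, ?_⟩⟩)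
      intro x hx
      rw [mem_sdiff] at hx
      exact mem_petal.2 ⟨hx.2, hPx x hx.1 hx.2⟩
  have h1 : #𝓕 ≤ C * n ^ (k - 1) +
      ∑ P ∈ kernPairs 𝓕 (k + 2 + 1), maxProd k #(petal 𝓕 (k + 2 + 1) P) := by
    refine (card_le_card hcov).trans ((card_union_le _ _).trans (add_le_add ?_
      (card_biUnion_le.trans (sum_le_sum fun P hP => ?_))))
    · exact card_filter_kernelHull_le h𝓕 (by omega)
    · exact card_filter_pair_le_maxProd (by omega) hint hP (card_le_card inter_subset_right)
  have h2 : k ^ k * #𝓕 ≤ k ^ k * C * n ^ (k - 1) +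
      ∑ P ∈ kernPairs 𝓕 (k + 2 + 1), #(petal 𝓕 (k + 2 + 1) P) ^ k := by
    refine (Nat.mul_le_mul_left _ h1).trans ?_
    rw [mul_add, ← mul_assoc, mul_sum]
    gcongr with P hP
    exact pow_mul_maxProd_le (by omega) _
  -- Bound k - 1 of the factors uniformly, one by n - `petalDefect k` and the others by n; the
  -- remaining first powers sum to at most n because petals are disjoint.
  have h3 : ∑ P ∈ kernPairs 𝓕 (k + 2 + 1), #(petal 𝓕 (k + 2 + 1) P) ^ k ≤
      n ^ (k - 1) * (n - petalDefect k) := by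
    calc _ ≤ ∑ P ∈ kernPairs 𝓕 (k + 2 + 1),
          #(petal 𝓕 (k + 2 + 1) P) * (n ^ (k - 2) * (n - petalDefect k)) := by
          refine sum_le_sum fun P hP => ?_
          have h4 := hcon P hP
          obtain ⟨l, rfl⟩ : ∃ l, k = l + 2 := ⟨k - 2, by omega⟩
          rw [pow_succ, pow_succ', mul_assoc, Nat.add_sub_cancel]
          refine Nat.mul_le_mul_left _ (Nat.mul_le_mul (Nat.pow_le_pow_left ?_ _) ?_) <;> omega
      _ ≤ n * (n ^ (k - 2) * (n - petalDefect k)) := by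
          rw [← sum_mul]
          exact Nat.mul_le_mul_right _ (sum_card_petal_le h𝓕 hint)
      _ = _ := by
          rw [← mul_assoc, ← pow_succ']
          congr 2
          omega
  have h5 := sub_pow_le_maxProd (by omega : 1 ≤ k) (n - 2)
  rw [Nat.sub_sub] at h5
  have h6 := pow_le_sub_pow_add n (2 + k) k
  have h7 := Nat.mul_le_mul_left (k ^ k) hcard
  have h8 : n ^ k ≤ n ^ (k - 1) * ((n - petalDefect k) + (petalDefect k - 1)) := by
    have : petalDefect k - 1 = k ^ k * C + (2 + k) * k := rfl
    rw [this, mul_add]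
    calc n ^ k ≤ k ^ k * C * n ^ (k - 1) + n ^ (k - 1) * (n - petalDefect k) +
          (2 + k) * k * n ^ (k - 1) := by omega
      _ = _ := by ring
  have hD : 1 ≤ petalDefect k := by simp [petalDefect]
  have h9 : n ^ k = n ^ (k - 1) * n := by
    rw [← pow_succ]
    congr 1
    omega
  rw [h9] at h8
  have h10 := Nat.le_of_mul_le_mul_left h8 (Nat.pow_pos (by omega))
  omega

/-- By `succ_mul_maxProd_le`, losing one vertex costs at least a 1/(n-2) fraction of `maxProd k (n -
2)`. That is of order n^(k-1) and beats E n^(k-2). -/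
theorem maxProd_gap {k n E : ℕ} (hk : 2 ≤ k) (hn : k ^ k * E + (2 + k) * k < n) (hn3 : 3 ≤ n) :
    E * n ^ (k - 2) + maxProd k (n - 3) < maxProd k (n - 2) := by
  by_contra! hcon
  have h1 := succ_mul_maxProd_le (by omega : 1 ≤ k) (n - 3)
  have e1 : n - 3 + 1 = n - 2 := by omega
  rw [e1] at h1
  have h2 := sub_pow_le_maxProd (by omega : 1 ≤ k) (n - 2)
  rw [Nat.sub_sub] at h2
  have h3 := pow_le_sub_pow_add n (2 + k) k
  have h4 : maxProd k (n - 2) ≤ E * n ^ (k - 1) := by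
    have h5 := Nat.mul_le_mul_left (n - 2) hcon
    have h6 : (n - 2) * maxProd k (n - 2) = (n - 3) * maxProd k (n - 2) + maxProd k (n - 2) := by
      rw [← e1]
      ring
    have h7 : (n - 2) * (E * n ^ (k - 2)) ≤ n * (E * n ^ (k - 2)) :=
      Nat.mul_le_mul_right _ (by omega)
    have h8 : n * (E * n ^ (k - 2)) = E * n ^ (k - 1) := by
      rw [mul_left_comm, ← pow_succ']
      congr 2
      omega
    rw [mul_add] at h5
    omega
  have h5 := Nat.mul_le_mul_left (k ^ k) h4
  have h9 : n ^ k = n ^ (k - 1) * n := by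
    rw [← pow_succ]
    congr 1
    omega
  have h10 : n ^ (k - 1) * n ≤ n ^ (k - 1) * (k ^ k * E + (2 + k) * k) := by
    rw [← h9]
    calc n ^ k ≤ k ^ k * (E * n ^ (k - 1)) + (2 + k) * k * n ^ (k - 1) := by omega
      _ = _ := by ring
  have h11 := Nat.le_of_mul_le_mul_left h10 (Nat.pow_pos (by omega))
  omega

theorem nonempty_iso_join {n k : ℕ} (hV : Fintype.card V = n) (hn : 2 ≤ n)
    {G : SimpleGraph V} {a b : V} (hab : G.Adj a b)
    (e : G.induce (commonNbhd G {a, b} : Set V) ≃g SimpleGraph.turanGraph (n - 2) k) :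
    Nonempty (G ≃g graphJoin (SimpleGraph.completeGraph (Fin 2))
      (SimpleGraph.turanGraph (n - 2) k)) := by
  let ψ : Fin 2 ⊕ Fin (n - 2) → V := Sum.elim ![a, b] fun j => e.symm j
  have hmem : ∀ j, G.Adj a (e.symm j) ∧ G.Adj b (e.symm j) := by
    intro j
    have := mem_commonNbhd.1 (e.symm j).2
    exact ⟨this a (by simp), this b (by simp)⟩
  have hmem' : ∀ (i : Fin 2) j, G.Adj (![a, b] i) (e.symm j) := by
    intro i j
    fin_cases i
    · exact (hmem j).1
    · exact (hmem j).2
  have hinj : Function.Injective ψ := by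
    rintro (i | i) (j | j) h
    · have h : ![a, b] i = ![a, b] j := h
      congr 1
      fin_cases i <;> fin_cases j <;> simp_all [hab.ne, hab.ne.symm]
    · exact absurd h (hmem' i j).ne
    · exact absurd h (hmem' j i).ne.symm
    · congr 1
      exact e.symm.injective (Subtype.ext h)
  have hbij : Function.Bijective ψ := by
    rw [Fintype.bijective_iff_injective_and_card]
    refine ⟨hinj, ?_⟩
    simp only [Fintype.card_sum, Fintype.card_fin, hV]
    omega
  refine ⟨SimpleGraph.Iso.symm ⟨Equiv.ofBijective ψ hbij, ?_⟩⟩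
  rintro (i | i) (j | j)
  · change G.Adj (![a, b] i) (![a, b] j) ↔ _
    fin_cases i <;> fin_cases j <;> simp [graphJoin, hab, hab.symm]
  · change G.Adj (![a, b] i) (e.symm j) ↔ _
    simp [graphJoin, hmem' i j]
  · change G.Adj (e.symm i) (![a, b] j) ↔ _
    simp [graphJoin, (hmem' j i).symm]
  · change (G.induce (commonNbhd G {a, b} : Set V)).Adj (e.symm i) (e.symm j) ↔ _
    rw [e.symm.map_adj_iff]
    simp [graphJoin]

/-- For large `n`, a graph without two `(k+2)`-cliques sharing exactly one vertex and with at least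
as many `(k+2)`-cliques as `K_2 ∨ T_k(n-2)` is isomorphic to this graph. -/
theorem card_cliquesIn_eq_and_nonempty_iso_join {k : ℕ} (hk : 3 ≤ k) :
    ∃ n₀ : ℕ, k + 2 ≤ n₀ ∧ ∀ (V : Type*) [Fintype V] (n : ℕ), Fintype.card V = n →
      n₀ ≤ n → ∀ G : SimpleGraph V,
      (∀ A ∈ cliquesIn G univ (k + 2), ∀ B ∈ cliquesIn G univ (k + 2), #(A ∩ B) ≠ 1) →
      maxProd k (n - 2) ≤ #(cliquesIn G univ (k + 2)) →
      #(cliquesIn G univ (k + 2)) = maxProd k (n - 2) ∧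
        Nonempty (G ≃g graphJoin (SimpleGraph.completeGraph (Fin 2))
          (SimpleGraph.turanGraph (n - 2) k)) := by
  set D := petalDefect k with hD
  -- 2^D bounds the cliques not containing P, and k + 2 is the coefficient of n^(k-2) in the count
  -- of cliques containing both P and a fixed vertex of F₀.
  set E := 2 ^ D + (k + 2) with hE
  refine ⟨k + 2 + D + (k ^ k * E + (2 + k) * k + 1), by omega, fun V _ n hV hn G hint hcard => ?_⟩
  set 𝓕 := cliquesIn G univ (k + 2) with h𝓕def
  have h𝓕 : ∀ F ∈ 𝓕, #F = k + 2 := fun F hF => (mem_cliquesIn.1 hF).2.1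
  obtain ⟨P, hP, hPn⟩ := exists_large_petal (G := G) hk hint (by rw [hV]; omega)
    (by rwa [hV])
  rw [hV, ← h𝓕def] at hPn
  have hP2 := (mem_kernPairs.1 hP).1
  have hSP : commonNbhd G P ⊆ univ \ P := fun x hx =>
    mem_sdiff.2 ⟨mem_univ x, fun hxP => G.irrefl (mem_commonNbhd.1 hx x hxP)⟩
  have hSc : #(univ \ P) = n - 2 := by
    rw [card_sdiff_of_subset (subset_univ P), card_univ, hV, hP2]
  have hSn : #(commonNbhd G P) ≤ n - 2 := hSc ▸ card_le_card hSP
  by_cases hall : ∀ F ∈ 𝓕, P ⊆ F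
  · have hfree := cliquesIn_commonNbhd_eq_empty hint hP
    have h1 : #𝓕 ≤ #(cliquesIn G (commonNbhd G P) k) := by
      have := card_filter_pair_le (G := G) (k := k) (P := P) (T := univ) hP2
      rwa [inter_univ, filter_true_of_mem fun F hF => ⟨hall F hF, subset_univ _⟩] at this
    have h2 := card_cliquesIn_le_maxProd hfree
    have h3 := maxProd_mono (by omega : 1 ≤ k) hSn
    refine ⟨by omega, ?_⟩
    -- Strict growth of `maxProd` leaves no room for a vertex outside P that is not adjacent to all
    -- of P.
    have hSeq : #(commonNbhd G P) = n - 2 := by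
      by_contra hne
      have h4 := maxProd_mono (by omega : 1 ≤ k) (by omega : #(commonNbhd G P) ≤ n - 3)
      have h5 := maxProd_lt_succ (by omega : 1 ≤ k) (by omega : k ≤ n - 3 + 1)
      rw [show n - 3 + 1 = n - 2 by omega] at h5
      omega
    have h6 : maxProd k #(commonNbhd G P) ≤ #(cliquesIn G (commonNbhd G P) k) := by
      rw [hSeq]
      omega
    obtain ⟨e⟩ := nonempty_iso_turanGraph_of_card_cliquesIn (by omega : 1 ≤ k)
      (by omega) hfree h6
    rw [hSeq] at e
    obtain ⟨F, hF⟩ : 𝓕.Nonempty := by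
      rw [← card_pos]
      exact (maxProd_pos (by omega : 1 ≤ k) (by omega)).trans_le hcard
    obtain ⟨a, b, hne, rfl⟩ := card_eq_two.1 hP2
    have hPF := hall F hF
    have hab : G.Adj a b := (mem_cliquesIn.1 hF).2.2 (hPF (by simp)) (hPF (by simp)) hne
    exact nonempty_iso_join hV (by omega) hab e
  · exfalso
    push Not at hall
    obtain ⟨F₀, hF₀, hPF₀⟩ := hall
    have hmeet : ∀ F ∈ 𝓕, ¬ P ⊆ F → F ⊆ univ \ (P ∪ petal 𝓕 (k + 2 + 1) P) := by
      intro F hF hPF x hx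
      exact mem_sdiff.2 ⟨mem_univ x, fun hxP => hPF (subset_of_mem_petal h𝓕 hint hP hF hxP hx)⟩
    have hrest : #(univ \ (P ∪ petal 𝓕 (k + 2 + 1) P)) ≤ D := by
      have h1 := card_le_card (subset_union_right : petal 𝓕 (k + 2 + 1) P ⊆ P ∪ _)
      rw [card_sdiff_of_subset (subset_univ _), card_univ, hV]
      omega
    obtain ⟨x, hx⟩ : F₀.Nonempty := by
      rw [← card_pos, h𝓕 F₀ hF₀]
      omega
    have hF₀P : ∀ y ∈ F₀, y ∉ P := fun y hy hyP =>
      (mem_sdiff.1 (hmeet F₀ hF₀ hPF₀ hy)).2 (mem_union_left _ hyP)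
    -- Three types of cliques: those not containing P, which live in at most D vertices; those
    -- containing P and x, which must share a second vertex y with F₀; and those containing P but
    -- avoiding x, which have only n - 3 vertices available outside P.
    have hcov : 𝓕 ⊆ (univ \ (P ∪ petal 𝓕 (k + 2 + 1) P)).powerset ∪
        (((F₀.erase x).biUnion fun y => univ.filter fun F : Finset V =>
          #F = k + 2 ∧ insert x (insert y P) ⊆ F) ∪
        𝓕.filter fun F => P ⊆ F ∧ F \ P ⊆ univ.erase x) := by
      intro F hF
      rw [mem_union, mem_union]
      by_cases hPF : P ⊆ F
      · refine .inr ?_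
        by_cases hxF : x ∈ F
        · left
          have h1 := hint F hF F₀ hF₀
          have h2 : 0 < #(F ∩ F₀) := card_pos.2 ⟨x, mem_inter.2 ⟨hxF, hx⟩⟩
          obtain ⟨y, hy, hyx⟩ := exists_mem_ne (by omega : 1 < #(F ∩ F₀)) x
          rw [mem_inter] at hy
          refine mem_biUnion.2 ⟨y, mem_erase.2 ⟨hyx, hy.2⟩, mem_filter.2 ⟨mem_univ _, h𝓕 F hF, ?_⟩⟩
          exact insert_subset hxF (insert_subset hy.1 hPF)
        · right
          refine mem_filter.2 ⟨hF, hPF, fun z hz => mem_erase.2 ⟨?_, mem_univ z⟩⟩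
          rintro rfl
          exact hxF (mem_sdiff.1 hz).1
      · exact .inl (mem_powerset.2 (hmeet F hF hPF))
    have b1 : #(univ \ (P ∪ petal 𝓕 (k + 2 + 1) P)).powerset ≤ 2 ^ D := by
      rw [card_powerset]
      exact Nat.pow_le_pow_right (by norm_num) hrest
    have b2 : #((F₀.erase x).biUnion fun y => univ.filter fun F : Finset V =>
          #F = k + 2 ∧ insert x (insert y P) ⊆ F) ≤ (k + 2) * n ^ (k - 2) := by
      refine (card_biUnion_le_card_mul _ _ (n ^ (k - 2)) fun y hy => ?_).trans
        (Nat.mul_le_mul_right _ ?_)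
      · rw [mem_erase] at hy
        refine (card_filter_superset_le (k + 2) (insert x (insert y P))).trans ?_
        rw [card_insert_of_notMem, card_insert_of_notMem (hF₀P y hy.2), hP2, hV]
        · exact Nat.pow_le_pow_right (by omega) (by omega)
        · rw [mem_insert, not_or]
          exact ⟨hy.1.symm, hF₀P x hx⟩
      · exact (card_erase_le).trans (h𝓕 F₀ hF₀).le
    have b3 : #(𝓕.filter fun F => P ⊆ F ∧ F \ P ⊆ univ.erase x) ≤ maxProd k (n - 3) := by
      refine card_filter_pair_le_maxProd (by omega) hint hP ?_
      have h1 : commonNbhd G P ∩ univ.erase x ⊆ (univ \ P).erase x := by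
        intro z hz
        rw [mem_inter, mem_erase] at hz
        exact mem_erase.2 ⟨hz.2.1, hSP hz.1⟩
      refine (card_le_card h1).trans ?_
      rw [card_erase_of_mem (mem_sdiff.2 ⟨mem_univ x, hF₀P x hx⟩), hSc]
      omega
    have h1 := (card_le_card hcov).trans (card_union_le _ _)
    have h2 := card_union_le ((F₀.erase x).biUnion fun y =>
      univ.filter fun F : Finset V => #F = k + 2 ∧ insert x (insert y P) ⊆ F)
      (𝓕.filter fun F => P ⊆ F ∧ F \ P ⊆ univ.erase x)
    have h3 := maxProd_gap (E := E) (by omega : 2 ≤ k) (by omega : _ < n) (by omega)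
    have h4 : 2 ^ D ≤ 2 ^ D * n ^ (k - 2) := Nat.le_mul_of_pos_right _ (Nat.pow_pos (by omega))
    rw [hE, add_mul] at h3
    omega

end Stability

/-! ### The main theorem. -/

theorem theorem1p4 (r : ℕ) (hr : 5 ≤ r) :
    ∃ n₀ : ℕ, 2 ≤ n₀ ∧ ∀ n : ℕ, n₀ ≤ n →
      generalizedTuranNumber n (SimpleGraph.completeGraph (Fin r)) (twoCliques r 1) =
          (SimpleGraph.turanGraph (n - 2) (r - 2)).copyCount
            (SimpleGraph.completeGraph (Fin (r - 2))) ∧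
      ∀ G : SimpleGraph (Fin n),
        ((twoCliques r 1).Free G ∧
            G.copyCount (SimpleGraph.completeGraph (Fin r)) =
              generalizedTuranNumber n (SimpleGraph.completeGraph (Fin r)) (twoCliques r 1)) ↔
          Nonempty (G ≃g graphJoin (SimpleGraph.completeGraph (Fin 2))
            (SimpleGraph.turanGraph (n - 2) (r - 2))) := by
  obtain ⟨k, rfl⟩ : ∃ k, r = k + 2 := ⟨r - 2, by omega⟩
  obtain ⟨n₀, hkn, hmain⟩ := card_cliquesIn_eq_and_nonempty_iso_join (by omega : 3 ≤ k)
  refine ⟨n₀, by omega, fun n hn => ?_⟩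
  rw [Nat.add_sub_cancel]
  have hturan := card_cliquesIn_turanGraph (by omega : 1 ≤ k) (by omega : k ≤ n - 2)
  have upper : ∀ G : SimpleGraph (Fin n), (twoCliques (k + 2) 1).Free G →
      maxProd k (n - 2) ≤ (cliquesIn G Finset.univ (k + 2)).card →
      (cliquesIn G Finset.univ (k + 2)).card = maxProd k (n - 2) ∧
        Nonempty (G ≃g graphJoin (SimpleGraph.completeGraph (Fin 2))
          (SimpleGraph.turanGraph (n - 2) k)) := fun G hG =>
    hmain (Fin n) n (Fintype.card_fin n) hn G fun _ hA _ hB => by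
      convert card_inter_ne_one_of_free (by omega) hG hA hB
  have lower : ∀ G : SimpleGraph (Fin n), Nonempty (G ≃g graphJoin
      (SimpleGraph.completeGraph (Fin 2)) (SimpleGraph.turanGraph (n - 2) k)) →
      (twoCliques (k + 2) 1).Free G ∧
        (cliquesIn G Finset.univ (k + 2)).card = maxProd k (n - 2) := by
    rintro G ⟨e⟩
    have hfree : (twoCliques (k + 2) 1).Free G :=
      (SimpleGraph.free_congr_right e).2
        (free_of_card_inter_ne_one (by omega) (card_inter_ne_one_join (by omega)))
    -- Only the lower bound on the construction's clique count has to be exhibited; the matching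
    -- upper bound comes from the general result applied to it.
    refine ⟨hfree, (upper G hfree ?_).1⟩
    rw [card_cliquesIn_eq_of_iso e, ← hturan]
    exact card_cliquesIn_turanGraph_le_join k (n - 2)
  have hex : generalizedTuranNumber n (SimpleGraph.completeGraph (Fin (k + 2)))
      (twoCliques (k + 2) 1) = maxProd k (n - 2) := by
    refine le_antisymm (Finset.sup_le fun G hG => ?_) ?_
    · rw [copyCount_completeGraph]
      have hfree : (twoCliques (k + 2) 1).Free G := by simpa using hG
      by_contra! hlt
      have := (upper G hfree hlt.le).1
      omega
    · let e : Fin 2 ⊕ Fin (n - 2) ≃ Fin n :=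
        finSumFinEquiv.trans (finCongr (by clear * - hn hkn; omega))
      obtain ⟨hfree, hc⟩ := lower _ ⟨(SimpleGraph.Iso.map e (graphJoin
        (SimpleGraph.completeGraph (Fin 2)) (SimpleGraph.turanGraph (n - 2) k))).symm⟩
      rw [← hc, ← copyCount_completeGraph]
      exact Finset.le_sup (f := fun G : SimpleGraph (Fin n) =>
        G.copyCount (SimpleGraph.completeGraph (Fin (k + 2))))
        (by simpa using hfree)
  refine ⟨by rw [hex, copyCount_completeGraph, hturan], fun G => ?_⟩
  rw [hex, copyCount_completeGraph]
  exact ⟨fun h => (upper G h.1 h.2.ge).2, lower G⟩
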